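/- Let $R$ be a unital associative ring, not necessarily commutative; modules are left $R$-modules unless stated otherwise. A module is a *PGF-module* (projectively coresolved Gorenstein flat) if it is a syzygy of an acyclic complex $P_*$ of projective modules such that the complex of abelian groups $I\otimes_R P_*$ is acyclic for every injective right module $I$. The PGF-dimension $\operatorname{PGF-dim}_R M$ of a module $M$ is the least $n\ge 0$ for which there is an exact sequence $0\to G_n\to\cdots\to G_0\to M\to 0$ with all $G_k$ PGF-modules, and $\infty$ if there is no such $n$. Let $M$ be a module with $\operatorname{PGF-dim}_R M<\infty$ and let $n\ge 0$ be an integer. Then the following conditions are equivalent: (i) $\operatorname{PGF-dim}_R M\le n$; (ii) $\operatorname{Ext}^i_R(M,F)=0$ for all $i>n$ and all flat modules $F$; (ii)$'$ $\operatorname{Ext}^i_R(M,P)=0$ for all $i>n$ and all projective modules $P$; (iii) $\operatorname{Ext}^i_R(M,F)=0$ for all $i>n$ and all modules $F$ of finite flat dimension; (iii)$'$ $\operatorname{Ext}^i_R(M,P)=0$ for all $i>n$ and all modules $P$ of finite projective dimension. -/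

import Mathlib

open CategoryTheory

universe u

namespace PGF

section Tensor

open TensorProduct

variable (R : Type u) [Ring R]

/-- The subgroup of `N ⊗_ℤ M` generated by the elements `(x · r) ⊗ m - x ⊗ (r m)`, for a right
`R`-module `N` (that is, an `Rᵐᵒᵖ`-module) and a left `R`-module `M`. -/
def balancing (N M : Type u) [AddCommGroup N] [Module Rᵐᵒᵖ N] [AddCommGroup M] [Module R M] :
    AddSubgroup (N ⊗[ℤ] M) :=
  AddSubgroup.closure
    {t | ∃ (x : N) (r : R) (m : M), t = (MulOpposite.op r • x) ⊗ₜ[ℤ] m - x ⊗ₜ[ℤ] (r • m)}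

/-- The abelian group `N ⊗_R M`, for a right module `N` and a left module `M` over a ring `R`
that need not be commutative. -/
abbrev Tensor (N M : Type u) [AddCommGroup N] [Module Rᵐᵒᵖ N] [AddCommGroup M] [Module R M] :
    Type u :=
  (N ⊗[ℤ] M) ⧸ balancing R N M

variable {R}

/-- The pure tensor `x ⊗ m` in `N ⊗_R M`. -/
def Tensor.tmul {N M : Type u} [AddCommGroup N] [Module Rᵐᵒᵖ N] [AddCommGroup M] [Module R M]
    (x : N) (m : M) : Tensor R N M :=
  QuotientAddGroup.mk' (balancing R N M) (x ⊗ₜ[ℤ] m)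

/-- The additive map `f ⊗ g : N ⊗_R M → N' ⊗_R M'`. -/
def Tensor.map {N N' M M' : Type u} [AddCommGroup N] [Module Rᵐᵒᵖ N] [AddCommGroup N']
    [Module Rᵐᵒᵖ N'] [AddCommGroup M] [Module R M] [AddCommGroup M'] [Module R M']
    (f : N →ₗ[Rᵐᵒᵖ] N') (g : M →ₗ[R] M') : Tensor R N M →+ Tensor R N' M' :=
  QuotientAddGroup.map (balancing R N M) (balancing R N' M')
    (TensorProduct.map f.toAddMonoidHom.toIntLinearMap
      g.toAddMonoidHom.toIntLinearMap).toAddMonoidHom <| by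
      rw [balancing, AddSubgroup.closure_le]
      rintro _ ⟨x, r, m, rfl⟩
      refine AddSubgroup.subset_closure ⟨f x, r, g m, ?_⟩
      rw [map_sub]
      change f (MulOpposite.op r • x) ⊗ₜ[ℤ] g m - f x ⊗ₜ[ℤ] g (r • m) = _
      rw [map_smul, map_smul]

theorem Tensor.map_tmul {N N' M M' : Type u} [AddCommGroup N] [Module Rᵐᵒᵖ N]
    [AddCommGroup N'] [Module Rᵐᵒᵖ N'] [AddCommGroup M] [Module R M] [AddCommGroup M']
    [Module R M'] (f : N →ₗ[Rᵐᵒᵖ] N') (g : M →ₗ[R] M') (x : N) (m : M) :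
    Tensor.map f g (Tensor.tmul x m) = Tensor.tmul (f x) (g m) :=
  rfl

theorem Tensor.hom_ext {N M A : Type u} [AddCommGroup N] [Module Rᵐᵒᵖ N] [AddCommGroup M]
    [Module R M] [AddCommGroup A] {f g : Tensor R N M →+ A}
    (h : ∀ (x : N) (m : M), f (Tensor.tmul x m) = g (Tensor.tmul x m)) : f = g := by
  apply QuotientAddGroup.addMonoidHom_ext
  ext t
  induction t with
  | zero => simp only [map_zero]
  | tmul x m => exact h x m
  | add a b ha hb => rw [map_add, map_add, ha, hb]

theorem Tensor.tmul_add {N M : Type u} [AddCommGroup N] [Module Rᵐᵒᵖ N] [AddCommGroup M]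
    [Module R M] (x : N) (m m' : M) :
    (Tensor.tmul x (m + m') : Tensor R N M) = Tensor.tmul x m + Tensor.tmul x m' := by
  simp only [Tensor.tmul, TensorProduct.tmul_add, map_add]

/-- The functor `N ⊗_R -` from left `R`-modules to abelian groups. -/
def tensorFunctor (N : ModuleCat.{u} Rᵐᵒᵖ) : ModuleCat.{u} R ⥤ AddCommGrpCat.{u} where
  obj M := AddCommGrpCat.of (Tensor R N M)
  map g := AddCommGrpCat.ofHom (Tensor.map LinearMap.id g.hom)
  map_id M := by
    apply AddCommGrpCat.hom_ext
    apply Tensor.hom_ext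
    intro x m
    rfl
  map_comp g h := by
    apply AddCommGrpCat.hom_ext
    apply Tensor.hom_ext
    intro x m
    rfl

instance (N : ModuleCat.{u} Rᵐᵒᵖ) : (tensorFunctor N).Additive where
  map_add {M M' g h} := by
    apply AddCommGrpCat.hom_ext
    apply Tensor.hom_ext
    intro x m
    exact Tensor.tmul_add x (g.hom m) (h.hom m)

end Tensor

variable {R : Type u} [Ring R]

/-- A left module `F` is flat if `- ⊗_R F` preserves injectivity of maps of right modules. -/
def IsFlat (F : ModuleCat.{u} R) : Prop :=
  ∀ (N N' : ModuleCat.{u} Rᵐᵒᵖ) (f : N →ₗ[Rᵐᵒᵖ] N'), Function.Injective f →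
    Function.Injective (Tensor.map f (LinearMap.id : F →ₗ[R] F))

/-- `M` is a projectively coresolved Gorenstein flat module: a syzygy of an acyclic complex `P` of
projective modules such that `I ⊗_R P` is acyclic for every injective right module `I`. -/
def IsPGF (M : ModuleCat.{u} R) : Prop :=
  ∃ P : ChainComplex (ModuleCat.{u} R) ℤ,
    P.Acyclic ∧
    (∀ i, Module.Projective R (P.X i)) ∧
    (∀ I : ModuleCat.{u} Rᵐᵒᵖ, Module.Injective Rᵐᵒᵖ I →
      (((tensorFunctor I).mapHomologicalComplex (ComplexShape.down ℤ)).obj P).Acyclic) ∧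
    ∃ i, Nonempty (M ≅ P.cycles i)

/-- There is an exact sequence `0 → G n → ⋯ → G 0 → M → 0` whose terms `G k` belong to the class
`C`. The sequence is continued to the left by zero modules. -/
def HasResolution (C : ModuleCat.{u} R → Prop) (M : ModuleCat.{u} R) (n : ℕ) : Prop :=
  ∃ (G : ℕ → ModuleCat.{u} R) (d : ∀ k, G (k + 1) →ₗ[R] G k) (ε : G 0 →ₗ[R] M),
    Function.Surjective ε ∧
    Function.Exact (d 0) ε ∧
    (∀ k, Function.Exact (d (k + 1)) (d k)) ∧
    (∀ k, k ≤ n → C (G k)) ∧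
    (∀ k, n < k → Subsingleton (G k))

/-- The minimal length of a resolution of `M` by modules in the class `C`; it is `⊤` if there is no
such resolution of finite length. -/
noncomputable def resolutionDim (C : ModuleCat.{u} R → Prop) (M : ModuleCat.{u} R) : ℕ∞ :=
  ⨅ (n : ℕ) (_ : HasResolution C M n), (n : ℕ∞)

/-- The PGF-dimension of a module. -/
noncomputable def pgfDim (M : ModuleCat.{u} R) : ℕ∞ := resolutionDim IsPGF M

/-- The flat dimension of a module. -/
noncomputable def flatDim (M : ModuleCat.{u} R) : ℕ∞ := resolutionDim IsFlat M

end PGF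

/-! The decisive fact is that `Ext` in positive degrees from a PGF-module to a flat module vanishes
(`IsPGF.extVanish`). It amounts to this: a complex of projectives that stays exact under `I ⊗ -` for
all injective right modules `I` also stays exact under `Hom(-, F)` for flat `F`. The complex is
folded into one square-zero endomorphism `D` of its direct sum and enlarged, by adding a
contractible part, to an endomorphism of a free module. A map to `F` is then a vector with entries
in `F`, and `D` acts on such vectors by a row-finite matrix. Tensor-exactness against a power of the
injective module `F⁺` gives exactness on finite sets of indices with uniform bounds
(`locallyExact_of_tensorExact`). A Mittag-Leffler argument on countable pieces together with Zorn's
lemma turns this into exactness (`LocallyExact.exists_rowAct_eq`).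

Since `Hom(P, I⁺) = (I ⊗ P)⁺`, tensor-exactness is governed by `Ext` into the modules `I⁺`. So
PGF-modules can be recognised without writing down complexes (`isPGF_of_class`), and they are closed
under extensions and direct summands. A module `M` of finite PGF-dimension then has an approximation
`0 → K → G → M → 0` with `G` PGF and `K` of finite projective dimension.

Resolutions and dimension shifting give the implications from the dimension bound down to vanishing
on projectives. Conversely, if `Ext` from `M` to projectives vanishes above `n`, then for `n = 0`
the approximation splits and `M` is a summand of `G`; for `n > 0` the projective dimension of `K` is
at most `n - 1`, and a projective resolution of `K` followed by `G` has length `n`. -/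

namespace PGF

/-! ### Row-finite matrices: local exactness implies exactness. -/

section RowFinite

variable {R : Type*} [Ring R] {B : Type*} {F : Type*} [AddCommGroup F] [Module R F]

/-- The action of a row-finite matrix `d` on column vectors with entries in a module. -/
noncomputable def rowAct (d : B → B →₀ R) : (B → F) →+ (B → F) where
  toFun h b := Finsupp.linearCombination R h (d b)
  map_zero' := by
    funext b
    simp
  map_add' h h' := by
    funext b
    simp [Finsupp.linearCombination_apply, Finsupp.sum_add]

theorem rowAct_apply (d : B → B →₀ R) (h : B → F) (b : B) :
    rowAct d h b = Finsupp.linearCombination R h (d b) := rfl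

theorem rowAct_congr (d : B → B →₀ R) {h h' : B → F} {b : B}
    (H : ∀ c ∈ (d b).support, h c = h' c) : rowAct d h b = rowAct d h' b := by
  rw [rowAct_apply, rowAct_apply, Finsupp.linearCombination_apply,
    Finsupp.linearCombination_apply]
  exact Finsupp.sum_congr fun c hc => by rw [H c hc]

theorem rowAct_eq_zero (d : B → B →₀ R) {h : B → F} {b : B}
    (H : ∀ c ∈ (d b).support, h c = 0) : rowAct d h b = 0 := by
  rw [rowAct_congr d (h' := 0) H, map_zero]
  rfl

/-- A set of indices which spans a subcomplex. -/
def RowClosed (d : B → B →₀ R) (S : Set B) : Prop :=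
  ∀ b ∈ S, ∀ c ∈ (d b).support, c ∈ S

/-- Local exactness, relative to the indices in `S`, of the complex of column vectors that are
supported on `C`: a vector which is a cycle on a large finite set of indices is a boundary on a
given finite set. -/
def LocallyExact (d : B → B →₀ R) (F : Type*) [AddCommGroup F] [Module R F] (S C : Set B) :
    Prop :=
  ∀ J : Finset B, (J : Set B) ⊆ C → ∃ K : Finset B, (K : Set B) ⊆ C ∧
    ∀ g : B → F, (∀ b ∈ S, g b = 0) → (∀ b ∈ K, rowAct d g b = 0) →
      ∃ h : B → F, (∀ b ∈ S, h b = 0) ∧ ∀ b ∈ J, g b = rowAct d h b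

variable {d : B → B →₀ R}

theorem RowClosed.rowAct_eq_zero {S : Set B} (hS : RowClosed d S) {h : B → F}
    (H : ∀ b ∈ S, h b = 0) (b : B) (hb : b ∈ S) : rowAct d h b = 0 :=
  PGF.rowAct_eq_zero d fun c hc => H c (hS b hb c hc)

/-- As `S` is row-closed, vectors vanishing on `S` form a subcomplex whose quotient is the complex
of vectors on `S`. This lemma and `LocallyExact.union` are the two-out-of-three property for that
sequence, with finite bounds carried along. -/
theorem LocallyExact.compl {S : Set B} (hB : LocallyExact d F ∅ Set.univ)
    (hS : LocallyExact d F ∅ S) (hSd : RowClosed d S) (hd : ∀ h : B → F, rowAct d (rowAct d h) = 0) :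
    LocallyExact d F S Sᶜ := by
  classical
  intro J hJ
  -- The primitive `h` of `g` need not vanish on `S`. Only its entries met by the rows in `J`
  -- matter, and there it is made to vanish by subtracting a boundary.
  set J₁ : Finset B := (J.biUnion fun b => (d b).support).filter (· ∈ S) with hJ₁
  obtain ⟨K₁, hK₁, H₁⟩ := hS J₁ (by intro b hb; simp [hJ₁] at hb; exact hb.2)
  obtain ⟨K, -, H⟩ := hB (J ∪ K₁) (Set.subset_univ _)
  refine ⟨K.filter (· ∉ S), by intro b hb; simp at hb; exact hb.2, fun g hg hgK => ?_⟩
  obtain ⟨h, -, hh⟩ := H g (by simp) fun b hb => by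
    by_cases hbS : b ∈ S
    · exact hSd.rowAct_eq_zero hg b hbS
    · exact hgK b (by simp [hb, hbS])
  obtain ⟨k, -, hk⟩ := H₁ h (by simp) fun b hb => by
    rw [← hh b (by simp [hb]), hg b (hK₁ hb)]
  refine ⟨fun b => if b ∈ S then 0 else (h - rowAct d k) b, fun b hb => by simp [hb],
    fun b hb => ?_⟩
  have h1 : rowAct d (h - rowAct d k) b = rowAct d h b := by
    rw [map_sub, hd, sub_zero]
  rw [hh b (by simp [hb]), ← h1]
  refine rowAct_congr d fun c hc => ?_
  by_cases hcS : c ∈ S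
  · have : c ∈ J₁ := by
      simp only [hJ₁, Finset.mem_filter, Finset.mem_biUnion]
      exact ⟨⟨b, hb, hc⟩, hcS⟩
    simp [hcS, hk c this]
  · simp [hcS]

theorem LocallyExact.union {S C : Set B} (hS : LocallyExact d F ∅ S) (hC : LocallyExact d F S C)
    (hSd : RowClosed d S)
    (hd : ∀ h : B → F, rowAct d (rowAct d h) = 0) : LocallyExact d F ∅ (S ∪ C) := by
  classical
  intro J hJ
  obtain ⟨K, hK, H⟩ := hC (J.filter (· ∉ S)) (by
    intro b hb
    simp at hb
    exact (hJ hb.1).resolve_left hb.2)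
  set J₁ : Finset B := ((K.biUnion fun b => (d b).support) ∪ J).filter (· ∈ S) with hJ₁
  obtain ⟨K₁, hK₁, H₁⟩ := hS J₁ (by intro b hb; simp [hJ₁] at hb; exact hb.2)
  refine ⟨K₁ ∪ K, ?_, fun g _ hgK => ?_⟩
  · rw [Finset.coe_union]
    exact Set.union_subset_union hK₁ hK
  obtain ⟨k, -, hk⟩ := H₁ g (by simp) fun b hb => hgK b (by simp [hb])
  set g' : B → F := fun b => if b ∈ S then 0 else (g - rowAct d k) b with hg'
  obtain ⟨h, hh, hhJ⟩ := H g' (fun b hb => by simp [hg', hb]) fun b hb => by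
    have h1 : rowAct d (g - rowAct d k) b = 0 := by
      rw [map_sub, hd, sub_zero]
      exact hgK b (by simp [hb])
    rw [← h1]
    refine rowAct_congr d fun c hc => ?_
    by_cases hcS : c ∈ S
    · have : c ∈ J₁ := by
        simp only [hJ₁, Finset.mem_filter, Finset.mem_union, Finset.mem_biUnion]
        exact ⟨Or.inl ⟨b, hb, hc⟩, hcS⟩
      simp [hg', hcS, hk c this]
    · simp [hg', hcS]
  refine ⟨k + h, by simp, fun b hb => ?_⟩
  rw [map_add, Pi.add_apply]
  by_cases hbS : b ∈ S
  · rw [hSd.rowAct_eq_zero hh b hbS, add_zero]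
    exact hk b (by simp [hJ₁, hb, hbS])
  · rw [← hhJ b (by simp [hb, hbS])]
    simp [hg', hbS]

theorem exists_countable_closure (c : Finset B → Finset B) (x : B) (T : Set B) (hx : x ∈ T)
    (hT : ∀ J : Finset B, (J : Set B) ⊆ T → (c J : Set B) ⊆ T) :
    ∃ C : Set B, C.Countable ∧ x ∈ C ∧ C ⊆ T ∧
      ∀ J : Finset B, (J : Set B) ⊆ C → (c J : Set B) ⊆ C := by
  classical
  obtain ⟨A, hA0, hA⟩ : ∃ A : ℕ → Finset B, A 0 = {x} ∧
      ∀ n, A (n + 1) = A n ∪ (A n).powerset.biUnion c :=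
    ⟨fun n => Nat.rec {x} (fun _ A => A ∪ A.powerset.biUnion c) n, rfl, fun _ => rfl⟩
  have hmono : Monotone A := monotone_nat_of_le_succ fun n => by
    rw [hA]
    exact Finset.subset_union_left
  refine ⟨⋃ n : ℕ, (A n : Set B), Set.countable_iUnion fun n => (A n).countable_toSet, ?_, ?_, ?_⟩
  · exact Set.mem_iUnion.2 ⟨0, by simp [hA0]⟩
  · refine Set.iUnion_subset fun n => ?_
    induction n with
    | zero => simpa [hA0] using hx
    | succ n ih =>
      rw [hA]
      intro b hb
      simp only [Finset.coe_union, Finset.coe_biUnion, Set.mem_union, Set.mem_iUnion,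
        Finset.mem_coe, Finset.mem_powerset] at hb
      obtain hb | ⟨J, hJ, hb⟩ := hb
      · exact ih hb
      · exact hT J (fun b hb => ih (hJ hb)) hb
  · intro J hJ
    have : ∃ n, J ⊆ A n := by
      induction J using Finset.induction_on with
      | empty => exact ⟨0, by simp⟩
      | insert a J _ ih =>
        rw [Finset.coe_insert, Set.insert_subset_iff] at hJ
        obtain ⟨n, hn⟩ := ih hJ.2
        obtain ⟨m, hm⟩ := Set.mem_iUnion.1 hJ.1
        refine ⟨max n m, Finset.insert_subset (hmono (le_max_right _ _) hm)
          (hn.trans (hmono (le_max_left _ _)))⟩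
    obtain ⟨n, hn⟩ := this
    intro b hb
    refine Set.mem_iUnion.2 ⟨n + 1, ?_⟩
    rw [hA]
    simp only [Finset.coe_union, Finset.coe_biUnion, Set.mem_union, Set.mem_iUnion,
      Finset.mem_coe, Finset.mem_powerset]
    exact Or.inr ⟨J, hn, hb⟩

/-- Both the bound `K` for a finite set and the support of a row are finite, so closing `{x}` under
these two operations leaves a countable set. -/
theorem LocallyExact.exists_countable {S : Set B} (hS : LocallyExact d F S Sᶜ)
    (hSd : RowClosed d S) {x : B} (hx : x ∉ S) :
    ∃ C : Set B, C.Countable ∧ x ∈ C ∧ C ⊆ Sᶜ ∧ RowClosed d (S ∪ C) ∧ LocallyExact d F S C := by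
  classical
  have : ∀ J : Finset B, ∃ K : Finset B, (J : Set B) ⊆ Sᶜ → (K : Set B) ⊆ Sᶜ ∧
    ∀ g : B → F, (∀ b ∈ S, g b = 0) → (∀ b ∈ K, rowAct d g b = 0) →
      ∃ h : B → F, (∀ b ∈ S, h b = 0) ∧ ∀ b ∈ J, g b = rowAct d h b := fun J => by
    by_cases hJ : (J : Set B) ⊆ Sᶜ
    · obtain ⟨K, hK⟩ := hS J hJ
      exact ⟨K, fun _ => hK⟩
    · exact ⟨∅, fun h => absurd h hJ⟩
  choose K hK using this
  obtain ⟨C, hC, hxC, hCS, H⟩ := exists_countable_closure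
    (fun J => K J ∪ (J.biUnion fun b => (d b).support).filter (· ∉ S)) x Sᶜ hx (fun J hJ => by
      rw [Finset.coe_union, Set.union_subset_iff]
      exact ⟨(hK J hJ).1, by intro b hb; simp at hb; exact hb.2⟩)
  refine ⟨C, hC, hxC, hCS, ?_, fun J hJ => ⟨K J, ?_, (hK J (hJ.trans hCS)).2⟩⟩
  · rintro b (hb | hb) c hc
    · exact Or.inl (hSd b hb c hc)
    · by_cases hcS : c ∈ S
      · exact Or.inl hcS
      · refine Or.inr (H {b} (by simpa using hb) ?_)
        simp only [Finset.coe_union, Set.mem_union, Finset.mem_coe, Finset.mem_filter,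
          Finset.mem_biUnion, Finset.mem_singleton]
        exact Or.inr ⟨⟨b, rfl, hc⟩, hcS⟩
  · refine Set.Subset.trans ?_ (H J hJ)
    simp

/-- A Mittag-Leffler argument: solutions on larger and larger finite sets are corrected by
boundaries until they stabilise at each index. -/
theorem LocallyExact.exists_eq_of_countable {S C : Set B} (hC : LocallyExact d F S C)
    (hSd : RowClosed d S) (hCd : RowClosed d (S ∪ C)) (hcount : C.Countable)
    (hd : ∀ h : B → F, rowAct d (rowAct d h) = 0) (f : B → F) (hf : rowAct d f = 0)
    (hfS : ∀ b ∈ S, f b = 0) :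
    ∃ g : B → F, (∀ b ∈ S, g b = 0) ∧ ∀ b ∈ C, rowAct d g b = f b := by
  classical
  obtain rfl | hne := C.eq_empty_or_nonempty
  · exact ⟨0, by simp, by simp⟩
  obtain ⟨e, he⟩ := hcount.exists_eq_range hne
  have : ∀ J : Finset B, ∃ K : Finset B, (J : Set B) ⊆ C → (K : Set B) ⊆ C ∧
    ∀ g : B → F, (∀ b ∈ S, g b = 0) → (∀ b ∈ K, rowAct d g b = 0) →
      ∃ h : B → F, (∀ b ∈ S, h b = 0) ∧ ∀ b ∈ J, g b = rowAct d h b := fun J => by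
    by_cases hJ : (J : Set B) ⊆ C
    · obtain ⟨K, hK⟩ := hC J hJ
      exact ⟨K, fun _ => hK⟩
    · exact ⟨∅, fun h => absurd h hJ⟩
  choose K hK using this
  -- an exhaustion of `C` by finite sets, each containing the bounds for its predecessor
  obtain ⟨J, hJ0, hJ⟩ : ∃ J : ℕ → Finset B, J 0 = ∅ ∧
      ∀ n, J (n + 1) = insert (e n) (J n ∪ K (J n)) :=
    ⟨fun n => Nat.rec ∅ (fun n J => insert (e n) (J ∪ K J)) n, rfl, fun _ => rfl⟩
  have hJC : ∀ n : ℕ, (J n : Set B) ⊆ C := fun n => by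
    induction n with
    | zero => simp [hJ0]
    | succ n ih =>
      rw [hJ, Finset.coe_insert, Finset.coe_union, Set.insert_subset_iff, Set.union_subset_iff]
      exact ⟨he ▸ Set.mem_range_self n, ih, (hK _ ih).1⟩
  have hKJ : ∀ n, K (J n) ⊆ J (n + 1) := fun n b hb => by simp [hJ, hb]
  have hmono : Monotone J := monotone_nat_of_le_succ fun n b hb => by simp [hJ, hb]
  have hfl : ∀ n, ∃ h : B → F, (∀ b ∈ S, h b = 0) ∧ ∀ b ∈ J n, rowAct d h b = f b := fun n => by
    obtain ⟨h, h1, h2⟩ := (hK _ (hJC n)).2 f hfS fun b _ => by rw [hf]; rfl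
    exact ⟨h, h1, fun b hb => (h2 b hb).symm⟩
  -- Stage `n` solves the equation on `J (n + 1)`, which contains `K (J n)`. Two such solutions
  -- therefore differ by a boundary on `J n`.
  let V : ℕ → Type _ := fun n =>
    {h : B → F // (∀ b ∈ S, h b = 0) ∧ ∀ b ∈ J (n + 1), rowAct d h b = f b}
  have step : ∀ n (h : V n), ∃ h' : V (n + 1), ∀ b ∈ J n, h'.1 b = h.1 b := fun n h => by
    obtain ⟨h', h1, h2⟩ := hfl (n + 2)
    obtain ⟨k, hk1, hk2⟩ := (hK _ (hJC n)).2 (h' - h.1)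
      (fun b hb => by simp [h1 b hb, h.2.1 b hb]) fun b hb => by
        rw [map_sub, Pi.sub_apply, h2 b (hmono (Nat.le_succ _) (hKJ n hb)),
          h.2.2 b (hKJ n hb), sub_self]
    refine ⟨⟨h' - rowAct d k, fun b hb => ?_, fun b hb => ?_⟩, fun b hb => ?_⟩
    · simp [h1 b hb, hSd.rowAct_eq_zero hk1 b hb]
    · rw [map_sub, hd, sub_zero, h2 b hb]
    · have := hk2 b hb
      simp only [Pi.sub_apply] at this ⊢
      rw [← this]
      abel
  choose next hnext using step
  obtain ⟨h0, h01, h02⟩ := hfl 1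
  let G : ∀ n, V n := fun n => Nat.rec ⟨h0, h01, h02⟩ (fun n h => next n h) n
  have hG : ∀ n, ∀ b ∈ J n, (G (n + 1)).1 b = (G n).1 b := fun n => hnext n (G n)
  have hG' : ∀ n m, n ≤ m → ∀ b ∈ J n, (G m).1 b = (G n).1 b := fun n m hnm b hb => by
    induction m, hnm using Nat.le_induction with
    | base => rfl
    | succ m hm ih => rw [hG m b (hmono hm hb), ih]
  have hex : ∀ b ∈ C, ∃ n, b ∈ J n := fun b hb => by
    rw [he] at hb
    obtain ⟨n, rfl⟩ := hb
    exact ⟨n + 1, by simp [hJ]⟩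
  -- The stable value. Zero is forced on `S`; the value outside `S ∪ C` is irrelevant, because rows
  -- in `C` do not reach there.
  let g : B → F := fun b =>
    if hb : b ∈ C then (if b ∈ S then 0 else (G (hex b hb).choose).1 b) else 0
  have hgn : ∀ n, ∀ b ∈ J n, g b = (G n).1 b := fun n b hb => by
    by_cases hbS : b ∈ S
    · simp [g, hbS, (G n).2.1 b hbS]
    · have hbC := hJC n hb
      simp only [g, hbS, hbC, dif_pos, if_neg, not_false_iff]
      rcases le_total n (hex b hbC).choose with h | h
      · exact hG' _ _ h b hb
      · exact (hG' _ _ h b (hex b hbC).choose_spec).symm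
  have hgS : ∀ b ∈ S, g b = 0 := fun b hb => by simp [g, hb]
  refine ⟨g, hgS, fun b hb => ?_⟩
  have : ∃ n, b ∈ J (n + 1) ∧ ∀ c ∈ (d b).support, c ∈ C → c ∈ J n := by
    obtain ⟨n, hn⟩ := hex b hb
    have : ∀ T : Finset B, ∃ m, ∀ c ∈ T, c ∈ C → c ∈ J m := fun T => by
      induction T using Finset.induction_on with
      | empty => exact ⟨0, by simp⟩
      | insert a T _ ih =>
        obtain ⟨m, hm⟩ := ih
        by_cases haC : a ∈ C
        · obtain ⟨l, hl⟩ := hex a haC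
          refine ⟨max m l, fun c hc hcC => ?_⟩
          rcases Finset.mem_insert.1 hc with rfl | hc
          · exact hmono (le_max_right _ _) hl
          · exact hmono (le_max_left _ _) (hm c hc hcC)
        · refine ⟨m, fun c hc hcC => ?_⟩
          rcases Finset.mem_insert.1 hc with rfl | hc
          · exact absurd hcC haC
          · exact hm c hc hcC
    obtain ⟨m, hm⟩ := this (d b).support
    exact ⟨max n m, hmono (le_max_left n m |>.trans (Nat.le_succ _)) hn,
      fun c hc hcC => hmono (le_max_right _ _) (hm c hc hcC)⟩
  obtain ⟨n, hn, hsupp⟩ := this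
  rw [← (G n).2.2 b hn]
  refine rowAct_congr d fun c hc => ?_
  rcases hCd b (Or.inr hb) c hc with hcS | hcC
  · rw [hgS c hcS, (G n).2.1 c hcS]
  · exact hgn n c (hsupp c hc hcC)

/-- A partial solution of `rowAct d g = f`, defined on a locally exact subcomplex. -/
structure PartialSolution (d : B → B →₀ R) (f : B → F) where
  carrier : Set B
  closed : RowClosed d carrier
  exact : LocallyExact d F ∅ carrier
  sol : B → F
  sol_eq : ∀ b ∈ carrier, rowAct d sol b = f b

instance (d : B → B →₀ R) (f : B → F) : Preorder (PartialSolution d f) where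
  le s t := s.carrier ⊆ t.carrier ∧ ∀ b ∈ s.carrier, t.sol b = s.sol b
  le_refl s := ⟨subset_rfl, fun _ _ => rfl⟩
  le_trans s t r h h' := ⟨h.1.trans h'.1, fun b hb => (h'.2 b (h.1 hb)).trans (h.2 b hb)⟩

/-- Local exactness and row-closedness test finite sets or single rows, so both pass to the union of
a chain. -/
theorem PartialSolution.bddAbove_of_isChain {f : B → F} (c : Set (PartialSolution d f))
    (hc : IsChain (· ≤ ·) c) (hne : c.Nonempty) : BddAbove c := by
  classical
  let S : Set B := ⋃ s ∈ c, s.carrier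
  have hS : ∀ b, b ∈ S ↔ ∃ s ∈ c, b ∈ s.carrier := fun b => by simp [S]
  have hfin : ∀ J : Finset B, (J : Set B) ⊆ S → ∃ s ∈ c, (J : Set B) ⊆ s.carrier := fun J hJ => by
    induction J using Finset.induction_on with
    | empty =>
      obtain ⟨s, hs⟩ := hne
      exact ⟨s, hs, by simp⟩
    | insert a J _ ih =>
      rw [Finset.coe_insert, Set.insert_subset_iff] at hJ
      obtain ⟨s, hs, hJs⟩ := ih hJ.2
      obtain ⟨t, ht, hat⟩ := (hS a).1 hJ.1
      rcases hc.total hs ht with h | h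
      · exact ⟨t, ht, by
          rw [Finset.coe_insert, Set.insert_subset_iff]; exact ⟨hat, hJs.trans h.1⟩⟩
      · exact ⟨s, hs, by
          rw [Finset.coe_insert, Set.insert_subset_iff]; exact ⟨h.1 hat, hJs⟩⟩
  let g : B → F := fun b => if hb : ∃ s ∈ c, b ∈ s.carrier then hb.choose.sol b else 0
  have hg : ∀ s ∈ c, ∀ b ∈ s.carrier, g b = s.sol b := fun s hs b hb => by
    have hex : ∃ s ∈ c, b ∈ s.carrier := ⟨s, hs, hb⟩
    simp only [g, hex, dif_pos]
    rcases hc.total hs hex.choose_spec.1 with h | h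
    · exact h.2 b hb
    · exact (h.2 b hex.choose_spec.2).symm
  refine ⟨⟨S, fun b hb x hx => ?_, fun J hJ => ?_, g, fun b hb => ?_⟩,
    fun s hs => ⟨fun b hb => ?_, hg s hs⟩⟩
  · obtain ⟨s, hs, hbs⟩ := (hS b).1 hb
    exact (hS x).2 ⟨s, hs, s.closed b hbs x hx⟩
  · obtain ⟨s, hs, hJs⟩ := hfin J hJ
    obtain ⟨K, hK, H⟩ := s.exact J hJs
    exact ⟨K, hK.trans fun b hb => (hS b).2 ⟨s, hs, hb⟩, H⟩
  · obtain ⟨s, hs, hbs⟩ := (hS b).1 hb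
    rw [← s.sol_eq b hbs]
    exact rowAct_congr d fun x hx => hg s hs x (s.closed b hbs x hx)
  · exact (hS b).2 ⟨s, hs, hb⟩

/-- A locally exact complex of column vectors is exact. -/
theorem LocallyExact.exists_rowAct_eq (hB : LocallyExact d F ∅ Set.univ)
    (hd : ∀ h : B → F, rowAct d (rowAct d h) = 0) (f : B → F) (hf : rowAct d f = 0) :
    ∃ g : B → F, rowAct d g = f := by
  have : Nonempty (PartialSolution d f) :=
    ⟨⟨∅, fun b hb => absurd hb (Set.notMem_empty b),
      fun J hJ => ⟨∅, by simp, fun g _ _ => ⟨0, by simp, fun b hb => absurd (hJ hb) (by simp)⟩⟩,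
      0, by simp⟩⟩
  obtain ⟨m, hm⟩ := zorn_le_nonempty (α := PartialSolution d f)
    PartialSolution.bddAbove_of_isChain
  suffices h : ∀ x, x ∈ m.carrier from ⟨m.sol, funext fun b => m.sol_eq b (h b)⟩
  by_contra! h
  obtain ⟨x, hx⟩ := h
  -- A maximal solution that misses `x` can be enlarged. The defect `f - rowAct d m.sol` is a cycle
  -- vanishing on the carrier, so it can be solved on a countable piece around `x` by a vector that
  -- leaves the old equations untouched.
  have hcompl := hB.compl m.exact m.closed hd
  obtain ⟨C, hcount, hxC, hCS, hCd, hCe⟩ := hcompl.exists_countable m.closed hx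
  obtain ⟨g, hgS, hgC⟩ := hCe.exists_eq_of_countable m.closed hCd hcount hd (f - rowAct d m.sol)
    (by rw [map_sub, hd, sub_zero, hf])
    (fun b hb => by rw [Pi.sub_apply, m.sol_eq b hb, sub_self])
  let t : PartialSolution d f :=
    ⟨m.carrier ∪ C, hCd, m.exact.union hCe m.closed hd, m.sol + g, fun b hb => by
      rw [map_add, Pi.add_apply]
      rcases hb with hb | hb
      · rw [m.closed.rowAct_eq_zero hgS b hb, add_zero, m.sol_eq b hb]
      · rw [hgC b hb]
        simp⟩
  exact hx ((hm (b := t) ⟨Set.subset_union_left, fun b hb => by simp [t, hgS b hb]⟩).1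
    (Or.inr hxC))

end RowFinite

/-! ### Characters with values in `ℚ/ℤ`. -/

section Characters

theorem exists_character_ne_zero {A : Type*} [AddCommGroup A] (H : AddSubgroup A) {a : A}
    (ha : a ∉ H) : ∃ χ : A →+ AddCircle (1 : ℚ), (∀ h ∈ H, χ h = 0) ∧ χ a ≠ 0 := by
  have : (QuotientAddGroup.mk' H a) ≠ 0 := fun h => ha ((QuotientAddGroup.eq_zero_iff a).1 h)
  obtain ⟨c, hc⟩ := CharacterModule.exists_character_apply_ne_zero_of_ne_zero this
  let c' : A ⧸ H →+ AddCircle (1 : ℚ) := c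
  refine ⟨c'.comp (QuotientAddGroup.mk' H), fun h hh => ?_, hc⟩
  have : QuotientAddGroup.mk' H h = 0 := (QuotientAddGroup.eq_zero_iff h).2 hh
  rw [AddMonoidHom.comp_apply, this, map_zero]

theorem exists_character_extension {A A' : Type*} [AddCommGroup A] [AddCommGroup A']
    (f : A →+ A') (hf : Function.Injective f) (χ : A →+ AddCircle (1 : ℚ)) :
    ∃ χ' : A' →+ AddCircle (1 : ℚ), ∀ a, χ' (f a) = χ a := by
  obtain ⟨χ', h⟩ := CharacterModule.dual_surjective_of_injective f.toIntLinearMap hf χ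
  exact ⟨χ', fun a => DFunLike.congr_fun h a⟩

end Characters

/-! ### Character modules of left and right modules. -/

section Dual

variable (R : Type u) [Ring R]

/-- The character module of a left module, as a right module. -/
def RightDual (F : Type u) [AddCommGroup F] : Type u := F →+ AddCircle (1 : ℚ)

/-- The character module of a right module, as a left module. -/
def LeftDual (N : Type u) [AddCommGroup N] : Type u := N →+ AddCircle (1 : ℚ)

instance (F : Type u) [AddCommGroup F] : AddCommGroup (RightDual F) :=
  inferInstanceAs (AddCommGroup (F →+ AddCircle (1 : ℚ)))

instance (F : Type u) [AddCommGroup F] : AddCommGroup (LeftDual F) :=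
  inferInstanceAs (AddCommGroup (F →+ AddCircle (1 : ℚ)))

instance (F : Type u) [AddCommGroup F] : FunLike (RightDual F) F (AddCircle (1 : ℚ)) :=
  inferInstanceAs (FunLike (F →+ AddCircle (1 : ℚ)) F (AddCircle (1 : ℚ)))

instance (F : Type u) [AddCommGroup F] : FunLike (LeftDual F) F (AddCircle (1 : ℚ)) :=
  inferInstanceAs (FunLike (F →+ AddCircle (1 : ℚ)) F (AddCircle (1 : ℚ)))

instance (F : Type u) [AddCommGroup F] :
    AddMonoidHomClass (RightDual F) F (AddCircle (1 : ℚ)) :=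
  inferInstanceAs (AddMonoidHomClass (F →+ AddCircle (1 : ℚ)) F (AddCircle (1 : ℚ)))

instance (F : Type u) [AddCommGroup F] :
    AddMonoidHomClass (LeftDual F) F (AddCircle (1 : ℚ)) :=
  inferInstanceAs (AddMonoidHomClass (F →+ AddCircle (1 : ℚ)) F (AddCircle (1 : ℚ)))

/-- Evaluation of characters, as a biadditive map. -/
def RightDual.eval (F : Type u) [AddCommGroup F] : RightDual F →+ F →+ AddCircle (1 : ℚ) :=
  AddMonoidHom.id (F →+ AddCircle (1 : ℚ))

/-- Evaluation of characters, as a biadditive map. -/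
def LeftDual.eval (F : Type u) [AddCommGroup F] : LeftDual F →+ F →+ AddCircle (1 : ℚ) :=
  AddMonoidHom.id (F →+ AddCircle (1 : ℚ))

variable {R}

theorem RightDual.eval_apply {F : Type u} [AddCommGroup F] (c : RightDual F) (x : F) :
    RightDual.eval F c x = c x := rfl

instance (F : Type u) [AddCommGroup F] [Module R F] : Module Rᵐᵒᵖ (RightDual F) where
  smul r c := (AddMonoidHom.comp (c : F →+ AddCircle (1 : ℚ)) (DistribSMul.toAddMonoidHom F r.unop) :
    F →+ AddCircle (1 : ℚ))
  one_smul c := DFunLike.ext _ _ fun x => congrArg c (one_smul R x)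
  mul_smul r s c := DFunLike.ext _ _ fun x => congrArg c (mul_smul s.unop r.unop x)
  smul_zero _ := rfl
  smul_add _ _ _ := rfl
  add_smul r s c := DFunLike.ext _ _ fun x =>
    (congrArg c (add_smul r.unop s.unop x)).trans (map_add c _ _)
  zero_smul c := DFunLike.ext _ _ fun x => (congrArg c (zero_smul R x)).trans (map_zero c)

instance (N : Type u) [AddCommGroup N] [Module Rᵐᵒᵖ N] : Module R (LeftDual N) where
  smul r c := (AddMonoidHom.comp (c : N →+ AddCircle (1 : ℚ))
    (DistribSMul.toAddMonoidHom N (MulOpposite.op r)) : N →+ AddCircle (1 : ℚ))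
  one_smul c := DFunLike.ext _ _ fun x => congrArg c (one_smul Rᵐᵒᵖ x)
  mul_smul r s c := DFunLike.ext _ _ fun x =>
    congrArg c (mul_smul (MulOpposite.op s) (MulOpposite.op r) x)
  smul_zero _ := rfl
  smul_add _ _ _ := rfl
  add_smul r s c := DFunLike.ext _ _ fun x =>
    (congrArg c (add_smul (MulOpposite.op r) (MulOpposite.op s) x)).trans (map_add c _ _)
  zero_smul c := DFunLike.ext _ _ fun x => (congrArg c (zero_smul Rᵐᵒᵖ x)).trans (map_zero c)

theorem RightDual.smul_apply {F : Type u} [AddCommGroup F] [Module R F] (r : Rᵐᵒᵖ)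
    (c : RightDual F) (x : F) : (r • c) x = c (r.unop • x) := rfl

theorem LeftDual.smul_apply {N : Type u} [AddCommGroup N] [Module Rᵐᵒᵖ N] (r : R)
    (c : LeftDual N) (x : N) : (r • c) x = c (MulOpposite.op r • x) := rfl

end Dual

/-! ### Tensor-hom duality, and exactness of `Hom` into flat modules for free modules. -/

section Tensor

open TensorProduct

variable {R : Type u} [Ring R]

variable {N M : Type u} [AddCommGroup N] [Module Rᵐᵒᵖ N] [AddCommGroup M] [Module R M]

theorem Tensor.induction_on {p : Tensor R N M → Prop} (t : Tensor R N M) (h0 : p 0)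
    (ht : ∀ x m, p (Tensor.tmul x m)) (ha : ∀ s t, p s → p t → p (s + t)) : p t := by
  obtain ⟨t, rfl⟩ := QuotientAddGroup.mk'_surjective _ t
  induction t with
  | zero => rw [map_zero]; exact h0
  | tmul x m => exact ht x m
  | add a b hx hy => rw [map_add]; exact ha _ _ hx hy

theorem Tensor.add_tmul (x y : N) (m : M) :
    (Tensor.tmul (x + y) m : Tensor R N M) = Tensor.tmul x m + Tensor.tmul y m := by
  simp only [Tensor.tmul, TensorProduct.add_tmul, map_add]

theorem Tensor.smul_tmul (r : R) (x : N) (m : M) :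
    (Tensor.tmul (MulOpposite.op r • x) m : Tensor R N M) = Tensor.tmul x (r • m) := by
  rw [← sub_eq_zero, Tensor.tmul, Tensor.tmul, ← map_sub]
  exact (QuotientAddGroup.eq_zero_iff _).2 (AddSubgroup.subset_closure ⟨x, r, m, rfl⟩)

/-- The pure tensors as a biadditive map. -/
def Tensor.mk (R : Type u) [Ring R] (N M : Type u) [AddCommGroup N] [Module Rᵐᵒᵖ N]
    [AddCommGroup M] [Module R M] : N →+ M →+ Tensor R N M :=
  AddMonoidHom.mk' (fun x => AddMonoidHom.mk' (fun m => Tensor.tmul x m) (Tensor.tmul_add x))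
    fun x y => AddMonoidHom.ext fun m => Tensor.add_tmul x y m

/-- The additive map on `N ⊗_R M` induced by a balanced biadditive map. -/
def Tensor.lift {A : Type*} [AddCommGroup A] (φ : N →+ M →+ A)
    (h : ∀ x (r : R) m, φ (MulOpposite.op r • x) m = φ x (r • m)) : Tensor R N M →+ A :=
  QuotientAddGroup.lift (balancing R N M)
    (TensorProduct.liftAddHom φ fun z x m => by rw [map_zsmul, map_zsmul]; rfl) <| by
      rw [balancing, AddSubgroup.closure_le]
      rintro _ ⟨x, r, m, rfl⟩
      rw [SetLike.mem_coe, AddMonoidHom.mem_ker, map_sub, TensorProduct.liftAddHom_tmul,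
        TensorProduct.liftAddHom_tmul, h, sub_self]

variable {N' N'' M' M'' : Type u} [AddCommGroup N'] [Module Rᵐᵒᵖ N'] [AddCommGroup N'']
  [Module Rᵐᵒᵖ N''] [AddCommGroup M'] [Module R M'] [AddCommGroup M''] [Module R M'']

theorem Tensor.map_map (f : N →ₗ[Rᵐᵒᵖ] N') (f' : N' →ₗ[Rᵐᵒᵖ] N'') (g : M →ₗ[R] M')
    (g' : M' →ₗ[R] M'') (t : Tensor R N M) :
    Tensor.map f' g' (Tensor.map f g t) = Tensor.map (f' ∘ₗ f) (g' ∘ₗ g) t :=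
  DFunLike.congr_fun (Tensor.hom_ext (f := (Tensor.map f' g').comp (Tensor.map f g))
    (g := Tensor.map (f' ∘ₗ f) (g' ∘ₗ g)) fun _ _ => rfl) t

theorem Tensor.map_id (t : Tensor R N M) :
    Tensor.map (LinearMap.id : N →ₗ[Rᵐᵒᵖ] N) (LinearMap.id : M →ₗ[R] M) t = t :=
  DFunLike.congr_fun (Tensor.hom_ext (f := Tensor.map LinearMap.id LinearMap.id)
    (g := AddMonoidHom.id (Tensor R N M)) fun _ _ => rfl) t

theorem Tensor.map_add_right (f : N →ₗ[Rᵐᵒᵖ] N') (g g' : M →ₗ[R] M') (t : Tensor R N M) :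
    Tensor.map f (g + g') t = Tensor.map f g t + Tensor.map f g' t :=
  DFunLike.congr_fun (Tensor.hom_ext (f := Tensor.map f (g + g'))
    (g := Tensor.map f g + Tensor.map f g') fun x m => Tensor.tmul_add (f x) (g m) (g' m)) t

/-- In contrast to `Tensor.hom_ext`, the target may lie in any universe, as characters require. -/
theorem Tensor.addMonoidHom_ext {A : Type*} [AddCommGroup A] {f g : Tensor R N M →+ A}
    (h : ∀ (x : N) (m : M), f (Tensor.tmul x m) = g (Tensor.tmul x m)) : f = g := by
  refine AddMonoidHom.ext fun t => ?_
  induction t using Tensor.induction_on with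
  | h0 => rw [map_zero, map_zero]
  | ht x m => exact h x m
  | ha s t hs ht => rw [map_add, map_add, hs, ht]

/-- The pairing of `N ⊗_R M` with `Hom_R(M, N⁺)`. -/
def Tensor.character (φ : M →ₗ[R] LeftDual N) : Tensor R N M →+ AddCircle (1 : ℚ) :=
  Tensor.lift ((LeftDual.eval N).comp φ.toAddMonoidHom).flip fun x r m => by
    change φ m _ = φ (r • m) x
    rw [LinearMap.map_smul, LeftDual.smul_apply]

theorem Tensor.character_comp (φ : M' →ₗ[R] LeftDual N) (g : M →ₗ[R] M') (t : Tensor R N M) :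
    Tensor.character (φ ∘ₗ g) t = Tensor.character φ (Tensor.map LinearMap.id g t) :=
  DFunLike.congr_fun (f := Tensor.character (φ ∘ₗ g))
    (g := (Tensor.character φ).comp
      (Tensor.map (LinearMap.id : N →ₗ[Rᵐᵒᵖ] N) g : Tensor R N M →+ Tensor R N M'))
    (Tensor.addMonoidHom_ext fun _ _ => rfl) t

/-- Every character of `N ⊗_R M` is given by a linear map `M → N⁺`. -/
theorem Tensor.exists_eq_character (χ : Tensor R N M →+ AddCircle (1 : ℚ)) :
    ∃ φ : M →ₗ[R] LeftDual N, Tensor.character φ = χ := by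
  refine ⟨{ toFun := fun m => (χ.comp ((Tensor.mk R N M).flip m) : N →+ AddCircle (1 : ℚ))
            map_add' := fun m m' => DFunLike.ext (F := LeftDual N) _ _ fun x => ?_
            map_smul' := fun r m => DFunLike.ext (F := LeftDual N) _ _ fun x => ?_ }, ?_⟩
  rotate_left 2
  · exact Tensor.addMonoidHom_ext fun x m => rfl
  · change χ (Tensor.tmul x (m + m')) = χ (Tensor.tmul x m) + χ (Tensor.tmul x m')
    rw [Tensor.tmul_add, map_add]
  · change χ (Tensor.tmul x (r • m)) = χ (Tensor.tmul (MulOpposite.op r • x) m)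
    rw [Tensor.smul_tmul]

/-- Maps `N → F⁺` are characters of `N ⊗ F`. Flatness makes `N ⊗ F → N' ⊗ F` injective, and
characters extend along injections. -/
theorem injective_rightDual {F : ModuleCat.{u} R} (hF : IsFlat F) :
    Module.Injective Rᵐᵒᵖ (RightDual F) := by
  refine ⟨fun N N' _ _ _ _ f hf φ => ?_⟩
  let χ : Tensor R N F →+ AddCircle (1 : ℚ) :=
    Tensor.lift ((RightDual.eval F).comp φ.toAddMonoidHom) fun x r m => by
      change φ (MulOpposite.op r • x) m = _
      rw [LinearMap.map_smul, RightDual.smul_apply]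
      rfl
  obtain ⟨χ', hχ'⟩ := exists_character_extension _
    (hF (ModuleCat.of Rᵐᵒᵖ N) (ModuleCat.of Rᵐᵒᵖ N') f hf) χ
  refine ⟨{ toFun := fun x => χ'.comp (Tensor.mk R N' F x)
            map_add' := fun x y => DFunLike.ext _ _ fun m => ?_
            map_smul' := fun r x => DFunLike.ext _ _ fun m => ?_ },
    fun x => DFunLike.ext _ _ fun m => hχ' (Tensor.tmul x m)⟩
  · change χ' (Tensor.tmul (x + y) m) = χ' (Tensor.tmul x m) + χ' (Tensor.tmul y m)
    rw [Tensor.add_tmul, map_add]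
  · change χ' (Tensor.tmul (r • x) m) = χ' (Tensor.tmul x (r.unop • m))
    rw [← Tensor.smul_tmul, MulOpposite.op_unop]

theorem injective_pi {S : Type u} [Ring S] (X : Type u) {I : Type u} [AddCommGroup I] [Module S I]
    (hI : Module.Injective S I) : Module.Injective S (X → I) := by
  refine ⟨fun N N' _ _ _ _ f hf φ => ?_⟩
  choose h hh using fun x => hI.out f hf (LinearMap.proj x ∘ₗ φ)
  exact ⟨LinearMap.pi h, fun n => funext fun x => hh x n⟩

theorem Tensor.exists_finsupp {B : Type u} (t : Tensor R N (B →₀ R)) :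
    ∃ y : B →₀ N, t = y.sum fun b n => Tensor.tmul n (Finsupp.single b 1) := by
  classical
  induction t using Tensor.induction_on with
  | h0 => exact ⟨0, by simp⟩
  | ht x m =>
    induction m using Finsupp.induction_linear with
    | zero => exact ⟨0, (Tensor.mk R N (B →₀ R) x).map_zero⟩
    | add m m' h h' =>
      obtain ⟨y, hy⟩ := h
      obtain ⟨y', hy'⟩ := h'
      refine ⟨y + y', ?_⟩
      rw [Tensor.tmul_add, hy, hy', Finsupp.sum_add_index']
      · exact fun b => ((Tensor.mk R N (B →₀ R)).flip _).map_zero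
      · exact fun b n n' => Tensor.add_tmul n n' _
    | single b r =>
      refine ⟨Finsupp.single b (MulOpposite.op r • x), ?_⟩
      rw [Finsupp.sum_single_index, Tensor.smul_tmul, Finsupp.smul_single, smul_eq_mul, mul_one]
      exact ((Tensor.mk R N (B →₀ R)).flip _).map_zero
  | ha s t hs ht =>
    obtain ⟨y, hy⟩ := hs
    obtain ⟨y', hy'⟩ := ht
    refine ⟨y + y', ?_⟩
    rw [hy, hy', Finsupp.sum_add_index']
    · exact fun b => ((Tensor.mk R N (B →₀ R)).flip _).map_zero
    · exact fun b n n' => Tensor.add_tmul n n' _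

/-- The endomorphism `D` becomes exact after tensoring with any injective right module. -/
def TensorExact (D : M →ₗ[R] M) : Prop :=
  ∀ I : ModuleCat.{u} Rᵐᵒᵖ, Module.Injective Rᵐᵒᵖ I → ∀ t : Tensor R I M,
    Tensor.map LinearMap.id D t = 0 → ∃ s, Tensor.map LinearMap.id D s = t

/-- Let `X` be the set of characters of `F^J` that kill all boundaries, and let `I = (F⁺)^X`, an
injective module. The tautological element `t` of `I ⊗ R^(B)` is a cycle, hence the image of some
`s`, and the finite support of `s` is the bound `K`. Pairing `t` with `x ∈ X` and a vector `g` gives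
`x(g|_J)`. Computed through `s`, the pairing involves only the entries of `rowAct d g` on `K`. If
these vanish, every `x ∈ X` kills `g|_J`, which is therefore a boundary. Taking all of `X` at once
makes `K` independent of `g`. -/
theorem locallyExact_of_tensorExact {B : Type u} (D : (B →₀ R) →ₗ[R] (B →₀ R))
    (hD : TensorExact D) {F : ModuleCat.{u} R} (hF : IsFlat F) :
    LocallyExact (fun b => D (Finsupp.single b 1)) F ∅ Set.univ := by
  classical
  intro J _
  set d : B → B →₀ R := fun b => D (Finsupp.single b 1)
  let X : Type u := {x : J → RightDual F // ∀ h : B → F, ∑ j, x j (rowAct d h j) = 0}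
  let I : ModuleCat.{u} Rᵐᵒᵖ := ModuleCat.of Rᵐᵒᵖ (X → RightDual F)
  let ξ : J → I := fun j x => x.1 j
  let t : Tensor R I (B →₀ R) := ∑ j, Tensor.tmul (ξ j) (Finsupp.single j.1 1)
  -- The defining condition of `X`, tested on vectors concentrated at the single index `c`.
  have hsum : ∀ (c : B) (x : X), ∑ j : J, MulOpposite.op (d j c) • x.1 j = 0 := fun c x => by
    refine DFunLike.ext _ _ fun f => ?_
    rw [← RightDual.eval_apply, map_sum, AddMonoidHom.finsetSum_apply]
    refine (Finset.sum_congr rfl fun j _ => ?_).trans (x.2 (Pi.single c f))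
    rw [RightDual.eval_apply, RightDual.smul_apply, MulOpposite.unop_op, rowAct_apply,
      Finsupp.linearCombination_apply]
    congr 1
    rw [Finsupp.sum, Finset.sum_eq_single c]
    · rw [Pi.single_eq_same]
    · intro b _ hb
      rw [Pi.single_eq_of_ne hb, smul_zero]
    · intro hc
      rw [Finsupp.notMem_support_iff.1 hc, zero_smul]
  have ht : Tensor.map LinearMap.id D t = 0 := by
    rw [map_sum]
    let K : Finset B := Finset.univ.biUnion fun j : J => (d j).support
    have h1 : ∀ j : J, Tensor.map LinearMap.id D (Tensor.tmul (ξ j) (Finsupp.single j.1 1)) =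
        ∑ c ∈ K, Tensor.mk R I (B →₀ R) (MulOpposite.op (d j c) • ξ j) (Finsupp.single c 1) := by
      intro j
      rw [Tensor.map_tmul]
      change Tensor.mk R I (B →₀ R) (ξ j) (d j) = _
      have h2 : d j = ∑ c ∈ K, d j c • Finsupp.single c 1 := by
        conv_lhs => rw [← Finsupp.sum_single (d j)]
        rw [Finsupp.sum]
        simp only [Finsupp.smul_single, smul_eq_mul, mul_one]
        refine Finset.sum_subset (fun c hc => Finset.mem_biUnion.2 ⟨j, Finset.mem_univ _, hc⟩) ?_
        intro c _ hc
        rw [Finsupp.notMem_support_iff.1 hc, Finsupp.single_zero]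
      conv_lhs => rw [h2, map_sum]
      exact Finset.sum_congr rfl fun c _ => (Tensor.smul_tmul _ _ _).symm
    rw [Finset.sum_congr rfl fun j _ => h1 j, Finset.sum_comm]
    refine Finset.sum_eq_zero fun c _ => ?_
    rw [← AddMonoidHom.finsetSum_apply, ← map_sum]
    have : ∑ j : J, MulOpposite.op (d j c) • ξ j = 0 := by
      funext x
      rw [Finset.sum_apply]
      exact hsum c x
    rw [this, map_zero]
    rfl
  obtain ⟨s, hs⟩ := hD I (injective_pi X (injective_rightDual hF)) t ht
  obtain ⟨y, hy⟩ := Tensor.exists_finsupp s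
  refine ⟨y.support, Set.subset_univ _, fun g _ hg => ?_⟩
  let res : (B → F) →+ (J → F) :=
    { toFun := fun h j => h j
      map_zero' := rfl
      map_add' := fun _ _ => rfl }
  suffices h : res g ∈ (res.comp (rowAct d)).range by
    obtain ⟨h, hh⟩ := h
    exact ⟨h, by simp, fun b hb => (congrFun hh ⟨b, hb⟩).symm⟩
  by_contra hcon
  obtain ⟨χ, hχ, hχg⟩ := exists_character_ne_zero _ hcon
  have hχsum : ∀ v : J → F, ∑ j, χ (Pi.single j (v j)) = χ v := fun v => by
    rw [← map_sum, Finset.univ_sum_single]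
  let x : X := ⟨fun j => χ.comp (AddMonoidHom.single (fun _ : J => (F : Type u)) j), fun h => by
    refine (hχsum (res (rowAct d h))).trans (hχ _ ⟨h, rfl⟩)⟩
  let pair : Tensor R I (B →₀ R) →+ AddCircle (1 : ℚ) :=
    Tensor.lift (((AddMonoidHom.compHom.flip
      (Finsupp.linearCombination R g).toAddMonoidHom).comp (RightDual.eval F)).comp
        (Pi.evalAddMonoidHom (fun _ : X => RightDual F) x)) fun i r p => by
      change (i x) (r • Finsupp.linearCombination R g p) =
        (i x) (Finsupp.linearCombination R g (r • p))
      rw [LinearMap.map_smul]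
  have hpair : ∀ (i : I) p, pair (Tensor.tmul i p) = (i x) (Finsupp.linearCombination R g p) :=
    fun _ _ => rfl
  apply hχg
  rw [← hχsum]
  have h1 : pair t = ∑ j, χ (Pi.single j (res g j)) := by
    rw [map_sum]
    refine Finset.sum_congr rfl fun j _ => ?_
    rw [hpair, Finsupp.linearCombination_single, one_smul]
    rfl
  rw [← h1, ← hs, hy, Finsupp.sum, map_sum, map_sum]
  refine Finset.sum_eq_zero fun b hb => ?_
  rw [Tensor.map_tmul, hpair]
  exact (congrArg _ (hg b hb)).trans (map_zero (y b x))

/-- A differential on a free module that is exact after tensoring with injective right modules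
remains exact under homomorphisms to a flat module. -/
theorem exists_comp_eq_of_tensorExact_finsupp {B : Type u} (D : (B →₀ R) →ₗ[R] (B →₀ R))
    (hDD : D ∘ₗ D = 0) (hD : TensorExact D) {F : ModuleCat.{u} R} (hF : IsFlat F)
    (f : (B →₀ R) →ₗ[R] F) (hf : f ∘ₗ D = 0) : ∃ g : (B →₀ R) →ₗ[R] F, g ∘ₗ D = f := by
  -- A map on the free module is the vector of its values on the basis. Composition with `D` becomes
  -- the action of the matrix whose rows are the images of the basis vectors.
  have key : ∀ (h : (B →₀ R) →ₗ[R] F),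
      rowAct (fun b => D (Finsupp.single b 1)) (fun b => h (Finsupp.single b 1)) =
        fun b => (h ∘ₗ D) (Finsupp.single b 1) := fun h => by
    funext b
    rw [rowAct_apply, LinearMap.comp_apply]
    refine DFunLike.congr_fun (f := Finsupp.linearCombination R
      (fun b => h (Finsupp.single b 1))) (g := h) ?_ _
    ext b
    simp
  have key' : ∀ h : B → F, rowAct (fun b => D (Finsupp.single b 1)) h =
      fun b => (Finsupp.linearCombination R h ∘ₗ D) (Finsupp.single b 1) := fun h => rfl
  obtain ⟨g, hg⟩ := (locallyExact_of_tensorExact D hD hF).exists_rowAct_eq (fun h => by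
    rw [key' h, key, LinearMap.comp_assoc, hDD, LinearMap.comp_zero]
    rfl) (fun b => f (Finsupp.single b 1)) (by rw [key, hf]; rfl)
  refine ⟨Finsupp.linearCombination R g, ?_⟩
  ext b
  simpa [key'] using congrFun hg b

end Tensor

variable {R : Type u} [Ring R]

/-! ### Transfer of exactness along homotopy retracts. -/

section Transfer

variable {M M' : Type u} [AddCommGroup M] [Module R M] [AddCommGroup M'] [Module R M']

theorem Tensor.map_comp_right {N M'' : Type u} [AddCommGroup N] [Module Rᵐᵒᵖ N]
    [AddCommGroup M''] [Module R M''] (g' : M' →ₗ[R] M'') (g : M →ₗ[R] M') (t : Tensor R N M) :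
    Tensor.map (LinearMap.id : N →ₗ[Rᵐᵒᵖ] N) (g' ∘ₗ g) t = Tensor.map
      (LinearMap.id : N →ₗ[Rᵐᵒᵖ] N) g' (Tensor.map (LinearMap.id : N →ₗ[Rᵐᵒᵖ] N) g t) := by
  rw [Tensor.map_map]
  rfl

theorem TensorExact.of_homotopy {D : M →ₗ[R] M} (hD : TensorExact D) {D' : M' →ₗ[R] M'}
    (i : M →ₗ[R] M') (r : M' →ₗ[R] M) (h : M' →ₗ[R] M') (hi : i ∘ₗ D = D' ∘ₗ i)
    (hr : r ∘ₗ D' = D ∘ₗ r) (hh : i ∘ₗ r + D' ∘ₗ h + h ∘ₗ D' = LinearMap.id) :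
    TensorExact D' := by
  intro I hI t ht
  obtain ⟨s, hs⟩ := hD I hI (Tensor.map LinearMap.id r t) (by
    rw [← Tensor.map_comp_right, ← hr, Tensor.map_comp_right, ht, map_zero])
  refine ⟨Tensor.map LinearMap.id i s + Tensor.map LinearMap.id h t, ?_⟩
  conv_rhs => rw [← Tensor.map_id t, ← hh, Tensor.map_add_right, Tensor.map_add_right,
    Tensor.map_comp_right h D', ht, map_zero, add_zero, Tensor.map_comp_right i r, ← hs,
    ← Tensor.map_comp_right, hi]
  rw [map_add, ← Tensor.map_comp_right, ← Tensor.map_comp_right]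

theorem exists_comp_eq_of_homotopy {D : M →ₗ[R] M} {D' : M' →ₗ[R] M'} {F : Type u}
    [AddCommGroup F] [Module R F] (i : M →ₗ[R] M') (r : M' →ₗ[R] M) (hi : i ∘ₗ D = D' ∘ₗ i)
    (hr : r ∘ₗ D' = D ∘ₗ r) (hri : r ∘ₗ i = LinearMap.id)
    (H : ∀ f : M' →ₗ[R] F, f ∘ₗ D' = 0 → ∃ g : M' →ₗ[R] F, g ∘ₗ D' = f)
    (f : M →ₗ[R] F) (hf : f ∘ₗ D = 0) : ∃ g : M →ₗ[R] F, g ∘ₗ D = f := by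
  obtain ⟨g, hg⟩ := H (f ∘ₗ r) (by
    rw [LinearMap.comp_assoc, hr, ← LinearMap.comp_assoc, hf, LinearMap.zero_comp])
  refine ⟨g ∘ₗ i, ?_⟩
  rw [LinearMap.comp_assoc, hi, ← LinearMap.comp_assoc, hg, LinearMap.comp_assoc, hri,
    LinearMap.comp_id]

theorem exists_comp_eq_of_tensorExact_free [Module.Free R M] (D : M →ₗ[R] M) (hDD : D ∘ₗ D = 0)
    (hD : TensorExact D) {F : ModuleCat.{u} R} (hF : IsFlat F) (f : M →ₗ[R] F)
    (hf : f ∘ₗ D = 0) : ∃ g : M →ₗ[R] F, g ∘ₗ D = f := by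
  let e := (Module.Free.chooseBasis R M).repr
  let i : M →ₗ[R] (Module.Free.ChooseBasisIndex R M →₀ R) := e.toLinearMap
  let r : (Module.Free.ChooseBasisIndex R M →₀ R) →ₗ[R] M := e.symm.toLinearMap
  have hri : r ∘ₗ i = LinearMap.id := LinearMap.ext fun x => e.symm_apply_apply x
  have hir : i ∘ₗ r = LinearMap.id := LinearMap.ext fun x => e.apply_symm_apply x
  have hi : i ∘ₗ D = (i ∘ₗ D ∘ₗ r) ∘ₗ i := by
    rw [LinearMap.comp_assoc, LinearMap.comp_assoc, hri, LinearMap.comp_id]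
  have hr : r ∘ₗ (i ∘ₗ D ∘ₗ r) = D ∘ₗ r := by
    rw [← LinearMap.comp_assoc, hri, LinearMap.id_comp]
  refine exists_comp_eq_of_homotopy i r hi hr hri
    (exists_comp_eq_of_tensorExact_finsupp _ ?_ (hD.of_homotopy i r 0 hi hr ?_) hF) f hf
  · rw [LinearMap.comp_assoc, LinearMap.comp_assoc, hr, ← LinearMap.comp_assoc r, hDD,
      LinearMap.zero_comp, LinearMap.comp_zero]
  · rw [hir, LinearMap.comp_zero, LinearMap.zero_comp, add_zero, add_zero]

end Transfer

/-! ### From free to projective modules by an Eilenberg swindle. -/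

section Telescope

variable {N : Type u} [AddCommGroup N] [Module R N]

/-- The differential that adds to `δ` in degree zero the maps `π n` between consecutive copies. -/
noncomputable def telescope (π : ℕ → N →ₗ[R] N) (δ : N →ₗ[R] N) : (ℕ →₀ N) →ₗ[R] (ℕ →₀ N) :=
  Finsupp.lsum ℕ fun n =>
    Finsupp.lsingle (n + 1) ∘ₗ π n + if n = 0 then Finsupp.lsingle 0 ∘ₗ δ else 0

/-- The contraction of the complementary summands in a telescope. -/
noncomputable def telescopeHomotopy (π : ℕ → N →ₗ[R] N) : (ℕ →₀ N) →ₗ[R] (ℕ →₀ N) :=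
  Finsupp.lsum ℕ fun n => Nat.casesOn n 0 fun n => Finsupp.lsingle n ∘ₗ π n

theorem telescope_single_zero (π : ℕ → N →ₗ[R] N) (δ : N →ₗ[R] N) (x : N) :
    telescope π δ (Finsupp.single 0 x) = Finsupp.single 1 (π 0 x) + Finsupp.single 0 (δ x) := by
  simp [telescope]

theorem telescope_single_succ (π : ℕ → N →ₗ[R] N) (δ : N →ₗ[R] N) (n : ℕ) (x : N) :
    telescope π δ (Finsupp.single (n + 1) x) = Finsupp.single (n + 2) (π (n + 1) x) := by
  simp [telescope]

theorem telescopeHomotopy_single_zero (π : ℕ → N →ₗ[R] N) (x : N) :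
    telescopeHomotopy π (Finsupp.single 0 x) = 0 := by
  simp [telescopeHomotopy]

theorem telescopeHomotopy_single_succ (π : ℕ → N →ₗ[R] N) (n : ℕ) (x : N) :
    telescopeHomotopy π (Finsupp.single (n + 1) x) = Finsupp.single n (π n x) := by
  simp [telescopeHomotopy]

end Telescope

/-- A differential on a direct summand of a free module that is exact after tensoring with
injective right modules remains exact under homomorphisms to a flat module. -/
theorem exists_comp_eq_of_tensorExact_retract {M N : Type u} [AddCommGroup M] [Module R M]
    [AddCommGroup N] [Module R N] [Module.Free R N] (s : M →ₗ[R] N) (p : N →ₗ[R] M)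
    (hps : ∀ x, p (s x) = x) (D : M →ₗ[R] M) (hDDx : ∀ x, D (D x) = 0)
    (hD : TensorExact D) {F : ModuleCat.{u} R} (hF : IsFlat F) (f : M →ₗ[R] F)
    (hf : f ∘ₗ D = 0) : ∃ g : M →ₗ[R] F, g ∘ₗ D = f := by
  let e : N →ₗ[R] N := s ∘ₗ p
  let δ : N →ₗ[R] N := s ∘ₗ D ∘ₗ p
  -- Write `N = M ⊕ M'` through the idempotent `e`. In countably many copies of `N`, the `M'` of
  -- copy `0` is sent identically to that of copy `1`, the `M` of copy `1` to that of copy `2`, and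
  -- so on alternately. Everything except the `M` of copy `0`, which carries `D`, is contractible,
  -- while the whole sum is free.
  let π : ℕ → N →ₗ[R] N := fun n => if Even n then LinearMap.id - e else e
  have hee : ∀ x, e (e x) = e x := fun x => by simp only [e, LinearMap.comp_apply, hps]
  have h0 : π 0 = LinearMap.id - e := by simp [π]
  have hδ0 : ∀ x, δ (π 0 x) = 0 := fun x => by
    rw [h0]
    simp only [δ, e, LinearMap.comp_apply, LinearMap.sub_apply, LinearMap.id_apply, map_sub, hps,
      sub_self]
  have h0δ : ∀ x, π 0 (δ x) = 0 := fun x => by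
    rw [h0]
    simp only [δ, e, LinearMap.comp_apply, LinearMap.sub_apply, LinearMap.id_apply, hps,
      sub_self]
  have hδδ : ∀ x, δ (δ x) = 0 := fun x => by
    simp only [δ, LinearMap.comp_apply, hps, hDDx, map_zero]
  have hππ : ∀ n x, π n (π n x) = π n x := fun n x => by
    by_cases hn : Even n <;> simp [π, hn, hee]
  have hπs : ∀ n x, π (n + 1) (π n x) = 0 := fun n x => by
    by_cases hn : Even n <;> simp [π, hn, hee, Nat.even_add_one]
  have hsum : ∀ n x, π n x + π (n + 1) x = x := fun n x => by
    by_cases hn : Even n <;> simp [π, hn, Nat.even_add_one]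
  let i : M →ₗ[R] (ℕ →₀ N) := Finsupp.lsingle 0 ∘ₗ s
  let r : (ℕ →₀ N) →ₗ[R] M := p ∘ₗ Finsupp.lapply 0
  have hi : i ∘ₗ D = telescope π δ ∘ₗ i := LinearMap.ext fun x => by
    have : π 0 (s x) = 0 := by
      rw [h0]
      simp only [e, LinearMap.comp_apply, LinearMap.sub_apply, LinearMap.id_apply, hps, sub_self]
    simp only [i, LinearMap.comp_apply, Finsupp.lsingle_apply, telescope_single_zero, this,
      Finsupp.single_zero, zero_add, δ, hps]
  have hr : r ∘ₗ telescope π δ = D ∘ₗ r := by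
    refine Finsupp.lhom_ext fun n x => ?_
    simp only [r, LinearMap.comp_apply, Finsupp.lapply_apply]
    cases n with
    | zero =>
      rw [telescope_single_zero]
      simp [δ, hps]
    | succ n =>
      rw [telescope_single_succ]
      simp
  have hh : i ∘ₗ r + telescope π δ ∘ₗ telescopeHomotopy π +
      telescopeHomotopy π ∘ₗ telescope π δ = LinearMap.id := by
    refine Finsupp.lhom_ext fun n x => ?_
    simp only [i, r, LinearMap.comp_apply, LinearMap.add_apply, Finsupp.lapply_apply,
      Finsupp.lsingle_apply, LinearMap.id_apply]
    cases n with
    | zero =>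
      rw [Finsupp.single_eq_same, telescope_single_zero, telescopeHomotopy_single_zero,
        map_zero (telescope π δ), map_add (telescopeHomotopy π), telescopeHomotopy_single_zero,
        telescopeHomotopy_single_succ, hππ, add_zero, add_zero, ← Finsupp.single_add, h0]
      simp [e]
    | succ n =>
      rw [telescope_single_succ, telescopeHomotopy_single_succ, telescopeHomotopy_single_succ,
        hππ, Finsupp.single_eq_of_ne (by simp), map_zero, map_zero, Finsupp.single_zero, zero_add]
      cases n with
      | zero =>
        rw [telescope_single_zero, hδ0, hππ, Finsupp.single_zero, add_zero, ← Finsupp.single_add,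
          hsum]
      | succ n =>
        rw [telescope_single_succ, hππ, ← Finsupp.single_add, hsum]
  have hri : r ∘ₗ i = LinearMap.id := LinearMap.ext fun x => by
    simp only [i, r, LinearMap.comp_apply, Finsupp.lapply_apply, Finsupp.lsingle_apply,
      Finsupp.single_eq_same, hps, LinearMap.id_apply]
  have hT : telescope π δ ∘ₗ telescope π δ = 0 := by
    refine Finsupp.lhom_ext fun n x => ?_
    rw [LinearMap.comp_apply, LinearMap.zero_apply]
    cases n with
    | zero =>
      rw [telescope_single_zero, map_add, telescope_single_zero, telescope_single_succ, hπs, h0δ,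
        hδδ]
      simp
    | succ n =>
      rw [telescope_single_succ, telescope_single_succ, hπs, Finsupp.single_zero]
  have hTE := hD.of_homotopy i r (telescopeHomotopy π) hi hr hh
  have hfree : Module.Free R (ℕ →₀ N) := Module.Free.finsupp R _ _
  have H := fun f' hf' => exists_comp_eq_of_tensorExact_free (telescope π δ) hT hTE hF f' hf'
  exact exists_comp_eq_of_homotopy i r hi hr hri H f hf

/-- A differential on a projective module that is exact after tensoring with injective right
modules remains exact under homomorphisms to a flat module. -/
theorem exists_comp_eq_of_tensorExact {M : Type u} [AddCommGroup M] [Module R M]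
    [Module.Projective R M] (D : M →ₗ[R] M) (hDD : D ∘ₗ D = 0)
    (hD : TensorExact D) {F : ModuleCat.{u} R} (hF : IsFlat F) (f : M →ₗ[R] F)
    (hf : f ∘ₗ D = 0) : ∃ g : M →ₗ[R] F, g ∘ₗ D = f := by
  obtain ⟨s, hs⟩ := Module.projective_def'.1 ‹Module.Projective R M›
  exact exists_comp_eq_of_tensorExact_retract s (Finsupp.linearCombination R id)
    (fun x => LinearMap.congr_fun hs x) D (fun x => LinearMap.congr_fun hDD x) hD hF f hf

/-! ### Folding a complex into one endomorphism of its direct sum. -/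

section Total

variable (P : ChainComplex (ModuleCat.{u} R) ℤ)

open DirectSum

/-- The differential on the direct sum of the terms of a complex. -/
noncomputable def totalDifferential : (⨁ i, P.X i) →ₗ[R] (⨁ i, P.X i) :=
  DirectSum.toModule R ℤ _ fun i => DirectSum.lof R ℤ (fun i => P.X i) (i - 1) ∘ₗ
    (P.d i (i - 1)).hom

theorem totalDifferential_lof (i j : ℤ) (hij : j + 1 = i) :
    totalDifferential P ∘ₗ DirectSum.lof R ℤ (fun i => P.X i) i =
      DirectSum.lof R ℤ (fun i => P.X i) j ∘ₗ (P.d i j).hom := by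
  obtain rfl : j = i - 1 := by lia
  refine LinearMap.ext fun x => ?_
  rw [LinearMap.comp_apply, totalDifferential, DirectSum.toModule_lof]

theorem component_totalDifferential (i j : ℤ) (hij : j + 1 = i) :
    DirectSum.component R ℤ (fun i => P.X i) j ∘ₗ totalDifferential P =
      (P.d i j).hom ∘ₗ DirectSum.component R ℤ (fun i => P.X i) i := by
  refine DirectSum.linearMap_ext R fun k => ?_
  rw [LinearMap.comp_assoc, LinearMap.comp_assoc, totalDifferential_lof P k (k - 1) (by lia)]
  refine LinearMap.ext fun x => ?_
  simp only [LinearMap.comp_apply]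
  by_cases hk : k = i
  · subst hk
    obtain rfl : j = k - 1 := by lia
    rw [DirectSum.component.lof_self, DirectSum.component.lof_self]
  · rw [DirectSum.component.of, DirectSum.component.of, dif_neg hk, dif_neg (by lia), map_zero]

theorem totalDifferential_comp_self : totalDifferential P ∘ₗ totalDifferential P = 0 := by
  refine DirectSum.linearMap_ext R fun k => ?_
  rw [LinearMap.comp_assoc, totalDifferential_lof P k (k - 1) (by lia), ← LinearMap.comp_assoc,
    totalDifferential_lof P (k - 1) (k - 1 - 1) (by lia), LinearMap.comp_assoc,
    ← ModuleCat.hom_comp, P.d_comp_d, ModuleCat.hom_zero, LinearMap.comp_zero, LinearMap.zero_comp]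

/-- Allowing every larger `T'` lets the finite sets for two summands be merged in the induction. -/
theorem Tensor.exists_eq_sum_components (I : ModuleCat.{u} Rᵐᵒᵖ) (t : Tensor R I (⨁ i, P.X i)) :
    ∃ T : Finset ℤ, ∀ T', T ⊆ T' → t = ∑ i ∈ T', Tensor.map LinearMap.id
      (DirectSum.lof R ℤ (fun i => P.X i) i)
        (Tensor.map LinearMap.id (DirectSum.component R ℤ (fun i => P.X i) i) t) := by
  classical
  induction t using Tensor.induction_on with
  | h0 => exact ⟨∅, fun T' _ => by simp⟩
  | ht x m =>
    refine ⟨DFinsupp.support m, fun T' hT' => ?_⟩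
    simp only [Tensor.map_tmul]
    have h1 : m = ∑ i ∈ T', DirectSum.lof R ℤ (fun i => P.X i) i
        (DirectSum.component R ℤ (fun i => P.X i) i m) := by
      conv_lhs => rw [← DirectSum.sum_support_of m]
      refine Finset.sum_subset hT' fun i _ hi => ?_
      rw [DFinsupp.notMem_support_iff.1 hi, map_zero]
    conv_lhs => rw [h1]
    exact map_sum (Tensor.mk R I _ x) _ _
  | ha s t hs ht =>
    obtain ⟨T, hT⟩ := hs
    obtain ⟨T₁, hT₁⟩ := ht
    refine ⟨T ∪ T₁, fun T' hT' => ?_⟩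
    simp only [map_add, Finset.sum_add_distrib]
    rw [← hT T' (Finset.union_subset_left hT'), ← hT₁ T' (Finset.union_subset_right hT')]

/-- The complex is exact after tensoring with injective right modules. -/
def TensorExactComplex : Prop :=
  ∀ I : ModuleCat.{u} Rᵐᵒᵖ, Module.Injective Rᵐᵒᵖ I → ∀ (i : ℤ) (t : Tensor R I (P.X i)),
    Tensor.map LinearMap.id (P.d i (i - 1)).hom t = 0 →
      ∃ s : Tensor R I (P.X (i + 1)), Tensor.map LinearMap.id (P.d (i + 1) i).hom s = t

variable {P}

theorem TensorExactComplex.total (hP : TensorExactComplex P) :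
    TensorExact (totalDifferential P) := by
  intro I hI t ht
  obtain ⟨T, hT⟩ := Tensor.exists_eq_sum_components P I t
  have : ∀ i : ℤ, ∃ s : Tensor R I (P.X (i + 1)), Tensor.map LinearMap.id (P.d (i + 1) i).hom s =
      Tensor.map LinearMap.id (DirectSum.component R ℤ (fun i => P.X i) i) t := fun i => by
    refine hP I hI i _ ?_
    rw [Tensor.map_map, ← component_totalDifferential P i (i - 1) (by lia), ← Tensor.map_map, ht,
      map_zero]
  choose s hs using this
  refine ⟨∑ i ∈ T, Tensor.map LinearMap.id (DirectSum.lof R ℤ (fun i => P.X i) (i + 1)) (s i), ?_⟩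
  rw [map_sum]
  conv_rhs => rw [hT T subset_rfl]
  refine Finset.sum_congr rfl fun i _ => ?_
  rw [Tensor.map_map, totalDifferential_lof P (i + 1) i rfl, ← Tensor.map_map, hs]

/-- A complex of projective modules that is exact after tensoring with injective right modules
remains exact under homomorphisms to a flat module. -/
theorem TensorExactComplex.exists_comp_eq (hP : TensorExactComplex P)
    (hproj : ∀ i, Module.Projective R (P.X i)) {F : ModuleCat.{u} R} (hF : IsFlat F) (i : ℤ)
    (f : P.X i →ₗ[R] F) (hf : f ∘ₗ (P.d (i + 1) i).hom = 0) :
    ∃ g : P.X (i - 1) →ₗ[R] F, g ∘ₗ (P.d i (i - 1)).hom = f := by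
  have : Module.Projective R (⨁ i, P.X i) := inferInstanceAs (Module.Projective R (Π₀ i, P.X i))
  obtain ⟨g, hg⟩ := exists_comp_eq_of_tensorExact (totalDifferential P)
    (totalDifferential_comp_self P) hP.total hF
    (f ∘ₗ DirectSum.component R ℤ (fun i => P.X i) i) (by
      rw [LinearMap.comp_assoc, component_totalDifferential P (i + 1) i rfl,
        ← LinearMap.comp_assoc, hf, LinearMap.zero_comp])
  refine ⟨g ∘ₗ DirectSum.lof R ℤ (fun i => P.X i) (i - 1), ?_⟩
  rw [LinearMap.comp_assoc, ← totalDifferential_lof P i (i - 1) (by lia), ← LinearMap.comp_assoc,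
    hg, LinearMap.comp_assoc]
  refine LinearMap.ext fun x => ?_
  rw [LinearMap.comp_apply, LinearMap.comp_apply, DirectSum.component.lof_self]

end Total

/-! ### Short exact sequences and dimension shifting for `Ext`. -/

section ShortExact

/-- A short exact sequence `0 → A → B → C → 0` of modules. -/
structure SES {A B C : Type u} [AddCommGroup A] [Module R A] [AddCommGroup B] [Module R B]
    [AddCommGroup C] [Module R C] (f : A →ₗ[R] B) (g : B →ₗ[R] C) : Prop where
  injective : Function.Injective f
  exact : Function.Exact f g
  surjective : Function.Surjective g

theorem exists_comp_eq_of_surjective {A B Y : Type*} [AddCommGroup A] [Module R A]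
    [AddCommGroup B] [Module R B] [AddCommGroup Y] [Module R Y] (g : A →ₗ[R] B)
    (hg : Function.Surjective g) (φ : A →ₗ[R] Y) (H : ∀ x, g x = 0 → φ x = 0) :
    ∃ ψ : B →ₗ[R] Y, ψ ∘ₗ g = φ := by
  let e := g.quotKerEquivOfSurjective hg
  refine ⟨(LinearMap.ker g).liftQ φ H ∘ₗ e.symm.toLinearMap, LinearMap.ext fun x => ?_⟩
  have : e.symm (g x) = Submodule.Quotient.mk x := by
    rw [LinearEquiv.symm_apply_eq]
    rfl
  rw [LinearMap.comp_apply, LinearMap.comp_apply, LinearEquiv.coe_coe, this]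
  rfl

variable {A B C : ModuleCat.{u} R} {f : A →ₗ[R] B} {g : B →ₗ[R] C}

theorem SES.comp_eq_zero (h : SES f g) : ModuleCat.ofHom f ≫ ModuleCat.ofHom g = 0 :=
  ModuleCat.hom_ext (LinearMap.ext fun x => h.exact.apply_apply_eq_zero x)

theorem SES.shortExact (h : SES f g) :
    (ShortComplex.mk (ModuleCat.ofHom f) (ModuleCat.ofHom g) h.comp_eq_zero).ShortExact :=
  ModuleCat.shortComplex_shortExact _ h.exact h.injective h.surjective

open Abelian

theorem SES.ext_middle (h : SES f g) {Y : ModuleCat.{u} R} {i : ℕ}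
    (hA : Subsingleton (Ext.{u} A Y i)) (hC : Subsingleton (Ext.{u} C Y i)) :
    Subsingleton (Ext.{u} B Y i) := by
  refine subsingleton_of_forall_eq 0 fun x => ?_
  obtain ⟨y, rfl⟩ := Ext.contravariant_sequence_exact₂ h.shortExact Y x (Subsingleton.elim _ _)
  rw [show y = 0 from Subsingleton.elim _ _, Ext.comp_zero]

theorem SES.ext_left (h : SES f g) {Y : ModuleCat.{u} R} {i : ℕ}
    (hB : Subsingleton (Ext.{u} B Y i)) (hC : Subsingleton (Ext.{u} C Y (i + 1))) :
    Subsingleton (Ext.{u} A Y i) := by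
  refine subsingleton_of_forall_eq 0 fun x => ?_
  obtain ⟨y, rfl⟩ := Ext.contravariant_sequence_exact₁ h.shortExact Y x (add_comm 1 i)
    (Subsingleton.elim (α := Ext.{u} C Y (i + 1)) _ _)
  rw [show y = 0 from Subsingleton.elim _ _, Ext.comp_zero]

theorem SES.ext_right (h : SES f g) {Y : ModuleCat.{u} R} {i : ℕ}
    (hA : Subsingleton (Ext.{u} A Y i)) (hB : Subsingleton (Ext.{u} B Y (i + 1))) :
    Subsingleton (Ext.{u} C Y (i + 1)) := by
  refine subsingleton_of_forall_eq 0 fun x => ?_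
  obtain ⟨y, rfl⟩ := Ext.contravariant_sequence_exact₃ h.shortExact Y x
    (Subsingleton.elim (α := Ext.{u} B Y (i + 1)) _ _) (add_comm 1 i)
  rw [show y = 0 from Subsingleton.elim _ _, Ext.comp_zero]

theorem SES.ext_right_covariant (h : SES f g) {X : ModuleCat.{u} R} {i : ℕ}
    (hB : Subsingleton (Ext.{u} X B i)) (hA : Subsingleton (Ext.{u} X A (i + 1))) :
    Subsingleton (Ext.{u} X C i) := by
  refine subsingleton_of_forall_eq 0 fun x => ?_
  obtain ⟨y, rfl⟩ := Ext.covariant_sequence_exact₃ X h.shortExact x rfl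
    (Subsingleton.elim (α := Ext.{u} X A (i + 1)) _ _)
  rw [show y = 0 from Subsingleton.elim _ _, Ext.zero_comp]

theorem SES.exists_extension (h : SES f g) {Y : ModuleCat.{u} R}
    (hC : Subsingleton (Ext.{u} C Y 1)) (φ : A →ₗ[R] Y) : ∃ ψ : B →ₗ[R] Y, ψ ∘ₗ f = φ := by
  obtain ⟨y, hy⟩ := Ext.contravariant_sequence_exact₁ h.shortExact Y
    (Ext.mk₀ (ModuleCat.ofHom φ)) (n₁ := 1) rfl (Subsingleton.elim (α := Ext.{u} C Y 1) _ _)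
  obtain ⟨ψ, rfl⟩ := (Ext.mk₀_bijective _ _).2 y
  refine ⟨ψ.hom, ?_⟩
  rw [Ext.mk₀_comp_mk₀] at hy
  exact congrArg ModuleCat.Hom.hom ((Ext.mk₀_bijective _ _).1 hy)

theorem SES.ext_one (h : SES f g) (hB : Module.Projective R B) {Y : ModuleCat.{u} R}
    (H : ∀ φ : A →ₗ[R] Y, ∃ ψ : B →ₗ[R] Y, ψ ∘ₗ f = φ) : Subsingleton (Ext.{u} C Y 1) := by
  have : Projective (ModuleCat.of R B) := (IsProjective.iff_projective B).1 hB
  refine subsingleton_of_forall_eq 0 fun x => ?_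
  obtain ⟨y, rfl⟩ := Ext.contravariant_sequence_exact₃ h.shortExact Y x
    (Ext.eq_zero_of_projective (P := ModuleCat.of R B) _) (n₀ := 0) rfl
  obtain ⟨φ, rfl⟩ := (Ext.mk₀_bijective _ _).2 y
  obtain ⟨ψ, hψ⟩ := H φ.hom
  have : φ = ModuleCat.ofHom f ≫ ModuleCat.ofHom ψ := ModuleCat.hom_ext hψ.symm
  rw [this, ← Ext.mk₀_comp_mk₀, ShortComplex.ShortExact.extClass_comp_assoc]

theorem ext_of_projective {P : ModuleCat.{u} R} (hP : Module.Projective R P) (Y : ModuleCat.{u} R)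
    (i : ℕ) : Subsingleton (Ext.{u} P Y (i + 1)) := by
  have : Projective P := (IsProjective.iff_projective P).1 hP
  exact subsingleton_of_forall_eq 0 fun x => Ext.eq_zero_of_projective x

theorem ext_of_retract {M N Y : ModuleCat.{u} R} (s : M →ₗ[R] N) (r : N →ₗ[R] M)
    (h : r ∘ₗ s = LinearMap.id) {i : ℕ} (hN : Subsingleton (Ext.{u} N Y i)) :
    Subsingleton (Ext.{u} M Y i) := by
  refine subsingleton_of_forall_eq 0 fun x => ?_
  have h1 : ModuleCat.ofHom s ≫ ModuleCat.ofHom r = 𝟙 M := ModuleCat.hom_ext h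
  rw [← Ext.mk₀_id_comp x, ← h1, ← Ext.mk₀_comp_mk₀_assoc,
    show (Ext.mk₀ (ModuleCat.ofHom r)).comp x (zero_add i) = 0 from Subsingleton.elim _ _,
    Ext.comp_zero]

theorem ext_of_iso_right {M Y Y' : ModuleCat.{u} R} (e : Y ≅ Y') {i : ℕ}
    (h : Subsingleton (Ext.{u} M Y i)) : Subsingleton (Ext.{u} M Y' i) := by
  refine subsingleton_of_forall_eq 0 fun x => ?_
  rw [← Ext.comp_mk₀_id x, ← e.inv_hom_id, ← Ext.mk₀_comp_mk₀,
    ← Ext.comp_assoc_of_third_deg_zero,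
    show x.comp (Ext.mk₀ e.inv) (add_zero i) = 0 from Subsingleton.elim _ _, Ext.zero_comp]

theorem ext_of_iso {M M' Y : ModuleCat.{u} R} (e : M ≅ M') {i : ℕ}
    (h : Subsingleton (Ext.{u} M' Y i)) : Subsingleton (Ext.{u} M Y i) :=
  ext_of_retract e.hom.hom e.inv.hom (congrArg ModuleCat.Hom.hom e.hom_inv_id) h

/-- All higher extension groups of `M` by `Y` vanish. -/
def ExtVanish (M Y : ModuleCat.{u} R) : Prop :=
  ∀ i : ℕ, Subsingleton (Ext.{u} M Y (i + 1))

/-- Extendability of maps from `Z (j + 1)` gives `Ext¹ = 0` on `Z j`; higher degrees on `Z j` shift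
to lower ones on `Z (j + 1)`. -/
theorem extVanish_of_sequence {Z P : ℤ → ModuleCat.{u} R} {f : ∀ j, Z j →ₗ[R] P j}
    {g : ∀ j, P j →ₗ[R] Z (j - 1)} (h : ∀ j, SES (f j) (g j))
    (hP : ∀ j, Module.Projective R (P j)) {Y : ModuleCat.{u} R}
    (hY : ∀ j (φ : Z j →ₗ[R] Y), ∃ ψ : P j →ₗ[R] Y, ψ ∘ₗ f j = φ) (j : ℤ) :
    ExtVanish (Z j) Y := by
  intro i
  induction i generalizing j with
  | zero =>
    have := (h (j + 1)).ext_one (hP _) (hY _)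
    rwa [add_sub_cancel_right] at this
  | succ i ih =>
    have := (h (j + 1)).ext_right (ih (j + 1)) (ext_of_projective (hP _) Y _)
    rwa [add_sub_cancel_right] at this

theorem exists_projective_ses (M : ModuleCat.{u} R) :
    ∃ (K P : ModuleCat.{u} R) (f : K →ₗ[R] P) (g : P →ₗ[R] M),
      Module.Projective R P ∧ SES f g := by
  let g : (M →₀ R) →ₗ[R] M := Finsupp.linearCombination R id
  refine ⟨ModuleCat.of R (LinearMap.ker g), ModuleCat.of R (M →₀ R), (LinearMap.ker g).subtype, g,
    inferInstanceAs (Module.Projective R (M →₀ R)),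
    ⟨Subtype.val_injective, LinearMap.exact_subtype_ker_map g, fun m => ⟨Finsupp.single m 1, ?_⟩⟩⟩
  simp [g]

end ShortExact

/-! ### PGF-modules: vanishing of `Ext` and recognition. -/

section Complexes

/-- Acyclicity in terms of elements. -/
theorem acyclic_iff (P : ChainComplex (ModuleCat.{u} R) ℤ) : P.Acyclic ↔
    ∀ (i : ℤ) (x : P.X i), (P.d i (i - 1)).hom x = 0 → ∃ y, (P.d (i + 1) i).hom y = x := by
  rw [HomologicalComplex.acyclic_iff]
  refine forall_congr' fun i => ?_
  rw [P.exactAt_iff' (i + 1) i (i - 1) (ChainComplex.prev _ _) (ChainComplex.next _ _),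
    ShortComplex.moduleCat_exact_iff]
  rfl

theorem tensorExactComplex_iff (P : ChainComplex (ModuleCat.{u} R) ℤ) : TensorExactComplex P ↔
    ∀ I : ModuleCat.{u} Rᵐᵒᵖ, Module.Injective Rᵐᵒᵖ I →
      (((tensorFunctor I).mapHomologicalComplex (ComplexShape.down ℤ)).obj P).Acyclic := by
  refine forall_congr' fun I => forall_congr' fun hI => ?_
  rw [HomologicalComplex.acyclic_iff]
  refine forall_congr' fun i => ?_
  rw [HomologicalComplex.exactAt_iff' _ (i + 1) i (i - 1) (ChainComplex.prev _ _)
    (ChainComplex.next _ _), ShortComplex.ab_exact_iff]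
  rfl

/-- Indexing by `j + 1` puts both differentials in the form `d (k + 1) k`, where `ChainComplex.of_d`
applies. -/
theorem acyclic_of_forall_succ {P : ChainComplex (ModuleCat.{u} R) ℤ}
    (H : ∀ (j : ℤ) (x : P.X (j + 1)), (P.d (j + 1) j).hom x = 0 →
      ∃ y, (P.d (j + 1 + 1) (j + 1)).hom y = x) : P.Acyclic := by
  rw [acyclic_iff]
  intro i
  obtain ⟨j, rfl⟩ : ∃ j, i = j + 1 := ⟨i - 1, by simp⟩
  have h : ∀ k, k = j → ∀ x : P.X (j + 1), (P.d (j + 1) k).hom x = 0 →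
      ∃ y, (P.d (j + 1 + 1) (j + 1)).hom y = x := by
    rintro _ rfl
    exact H _
  exact h _ (add_sub_cancel_right j 1)

theorem tensorExactComplex_of_forall_succ {P : ChainComplex (ModuleCat.{u} R) ℤ}
    (H : ∀ I : ModuleCat.{u} Rᵐᵒᵖ, Module.Injective Rᵐᵒᵖ I →
      ∀ (j : ℤ) (t : Tensor R I (P.X (j + 1))),
        Tensor.map LinearMap.id (P.d (j + 1) j).hom t = 0 →
          ∃ s : Tensor R I (P.X (j + 1 + 1)),
            Tensor.map LinearMap.id (P.d (j + 1 + 1) (j + 1)).hom s = t) :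
    TensorExactComplex P := by
  intro I hI i
  obtain ⟨j, rfl⟩ : ∃ j, i = j + 1 := ⟨i - 1, by simp⟩
  have h : ∀ k, k = j → ∀ t : Tensor R I (P.X (j + 1)),
      Tensor.map LinearMap.id (P.d (j + 1) k).hom t = 0 →
        ∃ s : Tensor R I (P.X (j + 1 + 1)),
          Tensor.map LinearMap.id (P.d (j + 1 + 1) (j + 1)).hom s = t := by
    rintro _ rfl
    exact H I hI _
  exact h _ (add_sub_cancel_right j 1)

theorem character_injective {N M : Type u} [AddCommGroup N] [Module Rᵐᵒᵖ N] [AddCommGroup M]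
    [Module R M] {φ ψ : M →ₗ[R] LeftDual N}
    (h : (Tensor.character φ : Tensor R N M →+ AddCircle (1 : ℚ)) = Tensor.character ψ) :
    φ = ψ :=
  LinearMap.ext fun m => DFunLike.ext _ _ fun x => DFunLike.congr_fun h (Tensor.tmul x m)

theorem Tensor.character_zero {N M : Type u} [AddCommGroup N] [Module Rᵐᵒᵖ N] [AddCommGroup M]
    [Module R M] (t : Tensor R N M) : Tensor.character (0 : M →ₗ[R] LeftDual N) t = 0 :=
  DFunLike.congr_fun (f := Tensor.character (0 : M →ₗ[R] LeftDual N)) (g := 0)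
    (Tensor.addMonoidHom_ext fun _ _ => rfl) t

/-- The left dual of a right module, as an object of the category of modules. -/
abbrev leftDual (I : ModuleCat.{u} Rᵐᵒᵖ) : ModuleCat.{u} R := ModuleCat.of R (LeftDual I)

/-- Under `Hom(P, I⁺) = (I ⊗ P)⁺`, the map `φ` is a character that kills the boundaries, hence the
cycles. It factors through the image of the differential and extends from there. -/
theorem TensorExactComplex.exists_comp_eq_leftDual {P : ChainComplex (ModuleCat.{u} R) ℤ}
    (hP : TensorExactComplex P) {I : ModuleCat.{u} Rᵐᵒᵖ} (hI : Module.Injective Rᵐᵒᵖ I) (i : ℤ)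
    (φ : P.X i →ₗ[R] LeftDual I) (hφ : φ ∘ₗ (P.d (i + 1) i).hom = 0) :
    ∃ ψ : P.X (i - 1) →ₗ[R] LeftDual I, ψ ∘ₗ (P.d i (i - 1)).hom = φ := by
  let δ : Tensor R I (P.X i) →+ Tensor R I (P.X (i - 1)) :=
    Tensor.map LinearMap.id (P.d i (i - 1)).hom
  have hker : ∀ t ∈ δ.ker, Tensor.character φ t = 0 := fun t ht => by
    obtain ⟨s, rfl⟩ := hP I hI i t ht
    rw [← Tensor.character_comp, hφ]
    exact Tensor.character_zero s
  obtain ⟨χ, hχ⟩ := exists_character_extension (QuotientAddGroup.kerLift δ)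
    (QuotientAddGroup.kerLift_injective δ) (QuotientAddGroup.lift δ.ker (Tensor.character φ) hker)
  obtain ⟨ψ, rfl⟩ := Tensor.exists_eq_character χ
  refine ⟨ψ, character_injective (N := I) (Tensor.addMonoidHom_ext fun x m => ?_)⟩
  exact hχ (QuotientAddGroup.mk' _ (Tensor.tmul x m))

theorem IsPGF.of_iso {M M' : ModuleCat.{u} R} (e : M ≅ M') (h : IsPGF M) : IsPGF M' := by
  obtain ⟨P, h1, h2, h3, i, ⟨e'⟩⟩ := h
  exact ⟨P, h1, h2, h3, i, ⟨e.symm ≪≫ e'⟩⟩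

/-- The cycles of a chain complex as a kernel. -/
abbrev kerCycles (P : ChainComplex (ModuleCat.{u} R) ℤ) (i : ℤ) : ModuleCat.{u} R :=
  ModuleCat.of R (LinearMap.ker (P.d i (i - 1)).hom)

/-- The cycles of a chain complex are the kernel of the differential. -/
noncomputable def cyclesIsoKer (P : ChainComplex (ModuleCat.{u} R) ℤ) (i : ℤ) :
    P.cycles i ≅ kerCycles P i :=
  P.cyclesIsoSc' (i + 1) i (i - 1) (ChainComplex.prev _ _) (ChainComplex.next _ _) ≪≫
    (P.sc' (i + 1) i (i - 1)).moduleCatCyclesIso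

/-- The differential of a complex, with values in the cycles. -/
def toKerCycles (P : ChainComplex (ModuleCat.{u} R) ℤ) (i : ℤ) :
    P.X i →ₗ[R] kerCycles P (i - 1) :=
  (P.d i (i - 1)).hom.codRestrict _ fun x => by
    rw [LinearMap.mem_ker, ← LinearMap.comp_apply, ← ModuleCat.hom_comp, P.d_comp_d]
    rfl

theorem ses_kerCycles {P : ChainComplex (ModuleCat.{u} R) ℤ} (hP : P.Acyclic) (i : ℤ) :
    SES (LinearMap.ker (P.d i (i - 1)).hom).subtype (toKerCycles P i) := by
  rw [acyclic_iff] at hP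
  refine ⟨Subtype.val_injective, fun x => ?_, fun x => ?_⟩
  · rw [Subtype.ext_iff]
    exact ⟨fun hx => ⟨⟨x, hx⟩, rfl⟩, fun ⟨y, hy⟩ => hy ▸ y.2⟩
  · have := hP (i - 1) x.1 x.2
    rw [sub_add_cancel] at this
    obtain ⟨y, hy⟩ := this
    exact ⟨y, Subtype.ext hy⟩

theorem kerCycles_exists_extension {P : ChainComplex (ModuleCat.{u} R) ℤ} (hP : P.Acyclic)
    {Y : ModuleCat.{u} R} (H : ∀ i (φ : P.X i →ₗ[R] Y), φ ∘ₗ (P.d (i + 1) i).hom = 0 →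
      ∃ ψ : P.X (i - 1) →ₗ[R] Y, ψ ∘ₗ (P.d i (i - 1)).hom = φ) (j : ℤ)
    (φ : kerCycles P j →ₗ[R] Y) :
    ∃ ψ : P.X j →ₗ[R] Y, ψ ∘ₗ (LinearMap.ker (P.d j (j - 1)).hom).subtype = φ := by
  obtain ⟨i, rfl⟩ : ∃ i, j = i - 1 := ⟨j + 1, by simp⟩
  obtain ⟨ψ, hψ⟩ := H i (φ ∘ₗ toKerCycles P i) (LinearMap.ext fun x => by
    have : toKerCycles P i ((P.d (i + 1) i).hom x) = 0 := Subtype.ext (by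
      change (P.d i (i - 1)).hom ((P.d (i + 1) i).hom x) = 0
      rw [← LinearMap.comp_apply, ← ModuleCat.hom_comp, P.d_comp_d]
      rfl)
    rw [LinearMap.comp_apply, LinearMap.comp_apply, this, map_zero]
    rfl)
  refine ⟨ψ, LinearMap.ext fun z => ?_⟩
  obtain ⟨x, rfl⟩ := (ses_kerCycles hP i).surjective z
  exact LinearMap.congr_fun hψ x

theorem IsPGF.extVanish_of {M : ModuleCat.{u} R} (hM : IsPGF M) {Y : ModuleCat.{u} R}
    (H : ∀ P : ChainComplex (ModuleCat.{u} R) ℤ, TensorExactComplex P →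
      (∀ i, Module.Projective R (P.X i)) →
      ∀ i (φ : P.X i →ₗ[R] Y), φ ∘ₗ (P.d (i + 1) i).hom = 0 →
      ∃ ψ : P.X (i - 1) →ₗ[R] Y, ψ ∘ₗ (P.d i (i - 1)).hom = φ) : ExtVanish M Y := by
  obtain ⟨P, h1, h2, h3, i, ⟨e⟩⟩ := hM
  exact fun k => ext_of_iso (e ≪≫ cyclesIsoKer P i) (extVanish_of_sequence (ses_kerCycles h1) h2
    (kerCycles_exists_extension h1 (H P ((tensorExactComplex_iff P).2 h3) h2)) i k)

/-- The higher extension groups of PGF-modules by flat modules vanish. -/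
theorem IsPGF.extVanish {M : ModuleCat.{u} R} (hM : IsPGF M) {F : ModuleCat.{u} R}
    (hF : IsFlat F) : ExtVanish M F :=
  hM.extVanish_of fun _ hP hproj i φ hφ => hP.exists_comp_eq hproj hF i φ hφ

theorem IsPGF.extVanish_leftDual {M : ModuleCat.{u} R} (hM : IsPGF M) {I : ModuleCat.{u} Rᵐᵒᵖ}
    (hI : Module.Injective Rᵐᵒᵖ I) : ExtVanish M (leftDual I) :=
  hM.extVanish_of fun _ hP _ i φ hφ => hP.exists_comp_eq_leftDual hI i φ hφ

/-- A PGF-module embeds in a projective module with PGF cokernel. -/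
theorem IsPGF.exists_ses {M : ModuleCat.{u} R} (hM : IsPGF M) :
    ∃ (P M' : ModuleCat.{u} R) (f : M →ₗ[R] P) (g : P →ₗ[R] M'),
      Module.Projective R P ∧ IsPGF M' ∧ SES f g := by
  obtain ⟨P, h1, h2, h3, i, ⟨e⟩⟩ := hM
  let e' := (e ≪≫ cyclesIsoKer P i).toLinearEquiv
  refine ⟨P.X i, kerCycles P (i - 1), (LinearMap.ker (P.d i (i - 1)).hom).subtype ∘ₗ e'.toLinearMap,
    toKerCycles P i, h2 i, ⟨P, h1, h2, h3, i - 1, ⟨(cyclesIsoKer P (i - 1)).symm⟩⟩, ?_, ?_, ?_⟩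
  · exact (ses_kerCycles h1 i).injective.comp e'.injective
  · intro x
    rw [(ses_kerCycles h1 i).exact x]
    exact ⟨fun ⟨y, hy⟩ => ⟨e'.symm y, by simpa using hy⟩, fun ⟨y, hy⟩ => ⟨e' y, hy⟩⟩
  · exact (ses_kerCycles h1 i).surjective

/-- The sequences are spliced. A tensor cycle that is not a boundary would be detected by a
character vanishing on boundaries, that is, by a map to `I⁺` factoring through `Z (j + 1)`. Since
`Ext¹(Z j, I⁺) = 0`, this map extends to `P j`, so the character kills every cycle. -/
theorem isPGF_of_sequence {Z P : ℤ → ModuleCat.{u} R} {f : ∀ j, Z (j + 1) →ₗ[R] P j}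
    {g : ∀ j, P j →ₗ[R] Z j} (h : ∀ j, SES (f j) (g j)) (hP : ∀ j, Module.Projective R (P j))
    (hZ : ∀ I : ModuleCat.{u} Rᵐᵒᵖ, Module.Injective Rᵐᵒᵖ I → ∀ j, ExtVanish (Z j) (leftDual I))
    (j : ℤ) : IsPGF (Z (j + 1)) := by
  let d : ∀ j, P (j + 1) →ₗ[R] P j := fun j => f j ∘ₗ g (j + 1)
  have hfg : ∀ j x, g j (f j x) = 0 := fun j x => (h j).exact.apply_apply_eq_zero x
  let Q : ChainComplex (ModuleCat.{u} R) ℤ := ChainComplex.of P (fun j => ModuleCat.ofHom (d j))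
    fun j => ModuleCat.hom_ext (LinearMap.ext fun x => by
      change f j (g (j + 1) (f (j + 1) (g (j + 1 + 1) x))) = 0
      rw [hfg, map_zero])
  have hd : ∀ j, (Q.d (j + 1) j).hom = d j := fun j =>
    congrArg ModuleCat.Hom.hom (ChainComplex.of_d P (fun j => ModuleCat.ofHom (d j)) j)
  have hker : ∀ j (x : P (j + 1)), d j x = 0 → ∃ y, d (j + 1) y = x := fun j x hx => by
    have hx' : g (j + 1) x = 0 := (h j).injective (hx.trans (map_zero (f j)).symm)
    obtain ⟨z, rfl⟩ := ((h (j + 1)).exact x).1 hx'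
    obtain ⟨y, rfl⟩ := (h (j + 1 + 1)).surjective z
    exact ⟨y, rfl⟩
  have hQ : Q.Acyclic := acyclic_of_forall_succ fun j => by
    rw [hd, hd]
    exact hker j
  have hT : TensorExactComplex Q := tensorExactComplex_of_forall_succ fun I hI j t => by
    rw [hd, hd]
    intro ht
    by_contra hcon
    obtain ⟨χ, hχ, hχt⟩ := exists_character_ne_zero
      (Tensor.map LinearMap.id (d (j + 1)) : Tensor R I (P (j + 1 + 1)) →+ _).range
      (a := t) hcon
    obtain ⟨φ, rfl⟩ := Tensor.exists_eq_character χ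
    have h1 : ∀ x, φ (d (j + 1) x) = 0 := fun x => DFunLike.ext _ _ fun y =>
      hχ _ ⟨Tensor.tmul y x, rfl⟩
    have h2 : ∀ x, g (j + 1) x = 0 → φ x = 0 := fun x hx => by
      obtain ⟨y, rfl⟩ := hker j x ((congrArg (f j) hx).trans (map_zero (f j)))
      exact h1 y
    obtain ⟨φ', hφ'⟩ :=
      exists_comp_eq_of_surjective (g (j + 1)) (h (j + 1)).surjective φ h2
    obtain ⟨ψ, hψ⟩ := (h j).exists_extension (Y := leftDual I) (hZ I hI j 0) φ'
    apply hχt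
    have : φ = ψ ∘ₗ d j := by
      rw [← hφ', ← hψ, LinearMap.comp_assoc]
    rw [this, Tensor.character_comp]
    exact (congrArg _ ht).trans (map_zero _)
  have hc : LinearMap.ker (Q.d j (j - 1)).hom = LinearMap.range (f j) := by
    obtain ⟨k, rfl⟩ : ∃ k, j = k + 1 := ⟨j - 1, by simp⟩
    have : ∀ l, l = k → LinearMap.ker (Q.d (k + 1) l).hom = LinearMap.range (f (k + 1)) := by
      rintro l rfl
      rw [hd]
      ext x
      rw [LinearMap.mem_ker, LinearMap.mem_range]
      refine ⟨fun hx => ?_, fun ⟨y, hy⟩ => ?_⟩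
      · obtain ⟨y, rfl⟩ := hker l x hx
        exact ⟨g _ y, rfl⟩
      · rw [← hy]
        exact (congrArg (f l) (hfg _ y)).trans (map_zero _)
    exact this _ (add_sub_cancel_right k 1)
  refine ⟨Q, hQ, hP, (tensorExactComplex_iff Q).1 hT, j, ⟨?_ ≪≫ (cyclesIsoKer Q j).symm⟩⟩
  exact ((LinearEquiv.ofInjective (f j) (h j).injective).trans
    (LinearEquiv.ofEq _ _ hc.symm)).toModuleIso

/-- A class of modules with vanishing higher extension groups by the duals of injective right
modules, each of which embeds in a projective module with cokernel in the class, consists of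
PGF-modules. -/
theorem isPGF_of_class (C : ModuleCat.{u} R → Prop)
    (hext : ∀ M, C M → ∀ I : ModuleCat.{u} Rᵐᵒᵖ, Module.Injective Rᵐᵒᵖ I →
      ExtVanish M (leftDual I))
    (hses : ∀ M, C M → ∃ (P M' : ModuleCat.{u} R) (f : M →ₗ[R] P) (g : P →ₗ[R] M'),
      Module.Projective R P ∧ C M' ∧ SES f g) {M : ModuleCat.{u} R} (hM : C M) : IsPGF M := by
  let Rel : ModuleCat.{u} R → ModuleCat.{u} R → Prop := fun A B =>
    ∃ (P : ModuleCat.{u} R) (f : A →ₗ[R] P) (g : P →ₗ[R] B), Module.Projective R P ∧ SES f g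
  let Good : ModuleCat.{u} R → Prop := fun A =>
    ∀ I : ModuleCat.{u} Rᵐᵒᵖ, Module.Injective Rᵐᵒᵖ I → ExtVanish A (leftDual I)
  have hnext : ∀ A : {A // C A}, ∃ B : {B // C B}, Rel A.1 B.1 := fun A => by
    obtain ⟨P, M', f, g, h1, h2, h3⟩ := hses A.1 A.2
    exact ⟨⟨M', h2⟩, P, f, g, h1, h3⟩
  -- To the left, projective covers need not stay in `C`. Only the vanishing of `Ext` is carried
  -- along, and this is all that splicing needs.
  have hprev : ∀ A : {A // Good A}, ∃ B : {B // Good B}, Rel B.1 A.1 := fun A => by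
    obtain ⟨K, P, f, g, h1, h2⟩ := exists_projective_ses A.1
    exact ⟨⟨K, fun I hI i => h2.ext_left (ext_of_projective h1 _ _) (A.2 I hI (i + 1))⟩,
      P, f, g, h1, h2⟩
  choose next hnext using hnext
  choose prev hprev using hprev
  let a : ℕ → {A // C A} := fun n => Nat.rec ⟨M, hM⟩ (fun _ A => next A) n
  let b : ℕ → {A // Good A} := fun n => Nat.rec ⟨M, hext M hM⟩ (fun _ A => prev A) n
  -- `M` sits at index `0`, its syzygies at positive indices and its cosyzygies at negative ones.
  let Z : ℤ → ModuleCat.{u} R := fun j => Int.casesOn j (fun n => (b n).1) fun n => (a (n + 1)).1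
  have hZ : ∀ j, Good (Z j) := fun j => by
    cases j with
    | ofNat n => exact (b n).2
    | negSucc n => exact hext _ (a (n + 1)).2
  have hRel : ∀ j, Rel (Z (j + 1)) (Z j) := fun j => by
    cases j with
    | ofNat n => exact hprev (b n)
    | negSucc n =>
      cases n with
      | zero => exact hnext (a 0)
      | succ n => exact hnext (a (n + 1))
  choose P f g hP hs using hRel
  exact isPGF_of_sequence hs hP (fun I hI j => hZ j I hI) (-1)

end Complexes

/-! ### Projectives, extensions and direct summands. -/

section ClosureProperties

/-- A dual basis gives coordinates `N ⊗ P → N`, natural in `N`, from which a tensor is recovered; an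
injective `f` reflects their vanishing. -/
theorem isFlat_of_projective {P : ModuleCat.{u} R} (hP : Module.Projective R P) : IsFlat P := by
  classical
  obtain ⟨s, hs⟩ := Module.projective_def'.1 hP
  intro N N' f hf
  let coord : ∀ (N : ModuleCat.{u} Rᵐᵒᵖ), P → Tensor R N P →+ N := fun N b =>
    Tensor.lift ((AddMonoidHom.mk' (fun x : N => AddMonoidHom.mk'
      (fun m : P => MulOpposite.op (s m b) • x) fun m m' => by
        rw [map_add, Finsupp.add_apply, MulOpposite.op_add, add_smul])) fun x y =>
          AddMonoidHom.ext fun m => smul_add _ x y) fun x r m => by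
      change MulOpposite.op (s m b) • MulOpposite.op r • x = MulOpposite.op (s (r • m) b) • x
      rw [map_smul, Finsupp.smul_apply, smul_eq_mul, MulOpposite.op_mul, mul_smul]
  have hcoord : ∀ (N : ModuleCat.{u} Rᵐᵒᵖ) (b : P) (x : N) (m : P),
      coord N b (Tensor.tmul x m) = MulOpposite.op (s m b) • x := fun _ _ _ _ => rfl
  have hsum : ∀ t : Tensor R N P, ∃ T : Finset P, ∀ T', T ⊆ T' →
      t = ∑ b ∈ T', Tensor.tmul (coord N b t) b := fun t => by
    induction t using Tensor.induction_on with
    | h0 =>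
      refine ⟨∅, fun T' _ => (Finset.sum_eq_zero fun b _ => ?_).symm⟩
      rw [map_zero]
      exact ((Tensor.mk R N P).flip b).map_zero
    | ht x m =>
      refine ⟨(s m).support, fun T' hT' => ?_⟩
      have h1 : m = ∑ b ∈ T', s m b • b := by
        have := LinearMap.congr_fun hs m
        rw [LinearMap.comp_apply, Finsupp.linearCombination_apply, LinearMap.id_apply] at this
        refine this.symm.trans (Finset.sum_subset hT' fun b _ hb => ?_)
        rw [Finsupp.notMem_support_iff.1 hb]
        exact zero_smul R b
      simp only [hcoord, Tensor.smul_tmul]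
      conv_lhs => rw [h1]
      exact map_sum (Tensor.mk R N P x) _ _
    | ha t t' ht ht' =>
      obtain ⟨T, hT⟩ := ht
      obtain ⟨T₁, hT₁⟩ := ht'
      refine ⟨T ∪ T₁, fun T' hT' => ?_⟩
      simp only [map_add, Tensor.add_tmul, Finset.sum_add_distrib]
      rw [← hT T' (Finset.union_subset_left hT'), ← hT₁ T' (Finset.union_subset_right hT')]
  have hnat : ∀ b (t : Tensor R N P),
      coord N' b (Tensor.map f LinearMap.id t) = f (coord N b t) := fun b t =>
    DFunLike.congr_fun (f := (coord N' b).comp (Tensor.map f LinearMap.id))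
      (g := f.toAddMonoidHom.comp (coord N b)) (Tensor.addMonoidHom_ext fun x m => by
        change MulOpposite.op (s m b) • f x = f (MulOpposite.op (s m b) • x)
        rw [LinearMap.map_smul]) t
  refine (injective_iff_map_eq_zero _).2 fun t ht => ?_
  obtain ⟨T, hT⟩ := hsum t
  rw [hT T subset_rfl]
  refine Finset.sum_eq_zero fun b _ => ?_
  have : coord N b t = 0 := hf (by rw [← hnat, ht, map_zero, map_zero])
  rw [this]
  exact ((Tensor.mk R N P).flip b).map_zero

theorem isPGF_of_projective {P : ModuleCat.{u} R} (hP : Module.Projective R P) : IsPGF P := by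
  refine isPGF_of_class (fun M => Module.Projective R M) (fun M hM I _ i => ext_of_projective hM _ i)
    (fun M hM => ⟨M, ModuleCat.of R PUnit.{u + 1}, LinearMap.id, 0, hM,
      inferInstanceAs (Module.Projective R PUnit.{u + 1}), Function.injective_id, fun x => ?_,
      fun x => ⟨0, rfl⟩⟩) hP
  exact ⟨fun _ => ⟨x, rfl⟩, fun _ => rfl⟩

/-- The quotient by the range of an injective map. -/
theorem ses_range_mkQ {A B : Type u} [AddCommGroup A] [Module R A] [AddCommGroup B] [Module R B]
    (f : A →ₗ[R] B) (hf : Function.Injective f) : SES f (LinearMap.range f).mkQ :=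
  ⟨hf, LinearMap.exact_map_mkQ_range f, Submodule.mkQ_surjective _⟩

/-- Extensions of PGF-modules by PGF-modules are PGF-modules. -/
theorem IsPGF.of_ses {A M B : ModuleCat.{u} R} {f : A →ₗ[R] M} {g : M →ₗ[R] B} (h : SES f g)
    (hA : IsPGF A) (hB : IsPGF B) : IsPGF M := by
  refine isPGF_of_class (fun M => ∃ (A B : ModuleCat.{u} R) (f : A →ₗ[R] M) (g : M →ₗ[R] B),
    IsPGF A ∧ IsPGF B ∧ SES f g) ?_ ?_ ⟨A, B, f, g, hA, hB, h⟩
  · rintro M ⟨A, B, f, g, hA, hB, h⟩ I hI i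
    exact h.ext_middle (hA.extVanish_leftDual hI i) (hB.extVanish_leftDual hI i)
  · rintro M ⟨A, B, f, g, hA, hB, h⟩
    obtain ⟨P, A', fA, gA, hP, hA', hsA⟩ := hA.exists_ses
    obtain ⟨Q, B', fB, gB, hQ, hB', hsB⟩ := hB.exists_ses
    -- The horseshoe construction on the coresolving side must extend `fA` from `A` to `M`. This is
    -- possible because `Ext¹(B, P) = 0`, by the vanishing of `Ext` into flat modules.
    obtain ⟨α, hα⟩ := h.exists_extension (hB.extVanish (isFlat_of_projective hP) 0) fA
    have hα' : ∀ a, α (f a) = fA a := fun a => LinearMap.congr_fun hα a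
    have hgf : ∀ a, g (f a) = 0 := fun a => h.exact.apply_apply_eq_zero a
    let φ : M →ₗ[R] (P × Q) := α.prod (fB ∘ₗ g)
    have hφ : Function.Injective φ := (injective_iff_map_eq_zero φ).2 fun m hm => by
      have h1 : α m = 0 := congrArg Prod.fst hm
      have h2 : fB (g m) = 0 := congrArg Prod.snd hm
      obtain ⟨a, rfl⟩ := (h.exact m).1 (hsB.injective (h2.trans (map_zero fB).symm))
      rw [hα'] at h1
      rw [hsA.injective (h1.trans (map_zero fA).symm), map_zero]
    let q := (LinearMap.range φ).mkQ
    have hq : ∀ x, q x = 0 ↔ ∃ m, φ m = x := fun x => (ses_range_mkQ φ hφ).exact x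
    obtain ⟨a, ha⟩ := exists_comp_eq_of_surjective gA hsA.surjective (q ∘ₗ LinearMap.inl R P Q)
      fun x hx => by
        obtain ⟨y, rfl⟩ := (hsA.exact x).1 hx
        refine (hq _).2 ⟨f y, Prod.ext (hα' y) ?_⟩
        change fB (g (f y)) = 0
        rw [hgf, map_zero]
    have ha' : ∀ x, a (gA x) = q (x, 0) := fun x => LinearMap.congr_fun ha x
    obtain ⟨b, hb⟩ := exists_comp_eq_of_surjective q (Submodule.mkQ_surjective _)
      (gB ∘ₗ LinearMap.snd R P Q) fun x hx => by
        obtain ⟨m, rfl⟩ := (hq _).1 hx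
        exact hsB.exact.apply_apply_eq_zero (g m)
    have hb' : ∀ x y, b (q (x, y)) = gB y := fun x y => LinearMap.congr_fun hb (x, y)
    have hPQ : Module.Projective R (P × Q) := inferInstance
    refine ⟨ModuleCat.of R (P × Q), ModuleCat.of R ((P × Q) ⧸ LinearMap.range φ), φ, q, hPQ,
      ⟨A', B', a, b, hA', hB', ?_, ?_, ?_⟩, ses_range_mkQ φ hφ⟩
    · refine (injective_iff_map_eq_zero a).2 fun x hx => ?_
      obtain ⟨x, rfl⟩ := hsA.surjective x
      rw [ha'] at hx
      obtain ⟨m, hm⟩ := (hq _).1 hx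
      have h1 : α m = x := congrArg Prod.fst hm
      have h2 : fB (g m) = 0 := congrArg Prod.snd hm
      obtain ⟨y, rfl⟩ := (h.exact m).1 (hsB.injective (h2.trans (map_zero fB).symm))
      rw [← h1, hα']
      exact hsA.exact.apply_apply_eq_zero y
    · intro z
      obtain ⟨⟨x, y⟩, rfl⟩ := Submodule.mkQ_surjective _ z
      change b (q (x, y)) = 0 ↔ _
      rw [hb']
      constructor
      · intro hy
        obtain ⟨c, rfl⟩ := (hsB.exact y).1 hy
        obtain ⟨m, rfl⟩ := h.surjective c
        refine ⟨gA (x - α m), ?_⟩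
        rw [ha']
        refine sub_eq_zero.1 ?_
        change q _ - q _ = 0
        rw [← map_sub]
        refine (hq _).2 ⟨-m, ?_⟩
        rw [map_neg]
        refine Prod.ext ?_ ?_
        · change -α m = (x - α m) - x
          abel
        · change -fB (g m) = 0 - fB (g m)
          abel
      · rintro ⟨w, hw⟩
        obtain ⟨w, rfl⟩ := hsA.surjective w
        rw [ha'] at hw
        rw [← hb' x y]
        exact (congrArg b hw).symm.trans ((hb' w 0).trans (map_zero gB))
    · intro z
      obtain ⟨y, rfl⟩ := hsB.surjective z
      exact ⟨q (0, y), hb' 0 y⟩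

/-- Direct summands of PGF-modules are PGF-modules. -/
theorem IsPGF.of_retract {M G : ModuleCat.{u} R} (hG : IsPGF G) (s : M →ₗ[R] G) (r : G →ₗ[R] M)
    (hrs : r ∘ₗ s = LinearMap.id) : IsPGF M := by
  refine isPGF_of_class (fun M => ∃ (G : ModuleCat.{u} R) (s : M →ₗ[R] G) (r : G →ₗ[R] M),
    IsPGF G ∧ r ∘ₗ s = LinearMap.id) ?_ ?_ ⟨G, s, r, hG, hrs⟩
  · rintro M ⟨G, s, r, hG, hrs⟩ I hI i
    exact ext_of_retract s r hrs (hG.extVanish_leftDual hI i)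
  · rintro M ⟨G, s, r, hG, hrs⟩
    have hrs' : ∀ x, r (s x) = x := fun x => LinearMap.congr_fun hrs x
    obtain ⟨P, G', f, g, hP, hG', h⟩ := hG.exists_ses
    have hgf : ∀ a, g (f a) = 0 := fun a => h.exact.apply_apply_eq_zero a
    have hs : Function.Injective s := Function.LeftInverse.injective hrs'
    have hφ : Function.Injective (f ∘ₗ s) := h.injective.comp hs
    let q := (LinearMap.range (f ∘ₗ s)).mkQ
    have hq : ∀ x, q x = 0 ↔ ∃ m, f (s m) = x := fun x => (ses_range_mkQ _ hφ).exact x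
    obtain ⟨b, hb⟩ := exists_comp_eq_of_surjective q (Submodule.mkQ_surjective _) g
      fun x hx => by
        obtain ⟨m, rfl⟩ := (hq _).1 hx
        exact hgf (s m)
    have hb' : ∀ x, b (q x) = g x := fun x => LinearMap.congr_fun hb x
    let X : ModuleCat.{u} R := ModuleCat.of R (P ⧸ LinearMap.range (f ∘ₗ s))
    -- The cokernel `X = P / M` contains `G / M`, with quotient `G'`. Adding the summand `M`
    -- restores `G`, so `X × M` is an extension of `G'` by `G`, and `X` is again a summand of a
    -- PGF-module.
    have hses : SES ((q ∘ₗ f).prod r : G →ₗ[R] ModuleCat.of R (X × M))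
        (b ∘ₗ LinearMap.fst R X M : ModuleCat.of R (X × M) →ₗ[R] G') := by
      refine ⟨(injective_iff_map_eq_zero _).2 fun y hy => ?_, fun z => ?_, fun z => ?_⟩
      · have h1 : q (f y) = 0 := congrArg Prod.fst hy
        have h2 : r y = 0 := congrArg Prod.snd hy
        obtain ⟨m, hm⟩ := (hq _).1 h1
        obtain rfl := h.injective hm
        rw [hrs'] at h2
        rw [h2, map_zero]
      · obtain ⟨x, m⟩ := z
        obtain ⟨x, rfl⟩ := Submodule.mkQ_surjective _ x
        change b (q x) = 0 ↔ _
        rw [hb']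
        constructor
        · intro hx
          obtain ⟨y, rfl⟩ := (h.exact x).1 hx
          refine ⟨y + s (m - r y), Prod.ext ?_ ?_⟩
          · change q (f (y + s (m - r y))) = q (f y)
            rw [map_add, map_add, (hq (f (s (m - r y)))).2 ⟨_, rfl⟩, add_zero]
          · change r (y + s (m - r y)) = m
            rw [map_add, hrs']
            abel
        · rintro ⟨y, hy⟩
          have h1 : q (f y) = q x := congrArg Prod.fst hy
          rw [← hb', ← h1, hb', hgf]
      · obtain ⟨x, rfl⟩ := h.surjective z
        exact ⟨(q x, 0), hb' x⟩
    exact ⟨P, X, f ∘ₗ s, q, hP, ⟨ModuleCat.of R (X × M), LinearMap.inl R X M,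
      LinearMap.fst R X M, IsPGF.of_ses hses hG hG', LinearMap.fst_comp_inl R X M⟩,
      ses_range_mkQ _ hφ⟩

end ClosureProperties

/-! ### Quotient and pushout diagrams. -/

section ExactSequences

/-- For `K ⊆ G ⊆ P` take `L = P / K`, which contains `M = G / K` with quotient `P / G = G'`. -/
theorem SES.exists_quotient {K G M P G' : ModuleCat.{u} R} {i : K →ₗ[R] G} {p : G →ₗ[R] M}
    {j : G →ₗ[R] P} {q : P →ₗ[R] G'} (h : SES i p) (h' : SES j q) :
    ∃ (L : ModuleCat.{u} R) (a : P →ₗ[R] L) (u : M →ₗ[R] L) (v : L →ₗ[R] G'),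
      SES (j ∘ₗ i) a ∧ SES u v := by
  have hji : Function.Injective (j ∘ₗ i) := h'.injective.comp h.injective
  let a := (LinearMap.range (j ∘ₗ i)).mkQ
  have ha : ∀ x, a x = 0 ↔ ∃ k, j (i k) = x := fun x => (ses_range_mkQ _ hji).exact x
  have has : Function.Surjective a := Submodule.mkQ_surjective _
  obtain ⟨u, hu⟩ := exists_comp_eq_of_surjective p h.surjective (a ∘ₗ j) fun x hx => by
    obtain ⟨k, rfl⟩ := (h.exact x).1 hx
    exact (ha _).2 ⟨k, rfl⟩
  have hu' : ∀ x, u (p x) = a (j x) := fun x => LinearMap.congr_fun hu x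
  obtain ⟨v, hv⟩ := exists_comp_eq_of_surjective a has q fun x hx => by
    obtain ⟨k, rfl⟩ := (ha _).1 hx
    exact h'.exact.apply_apply_eq_zero (i k)
  have hv' : ∀ x, v (a x) = q x := fun x => LinearMap.congr_fun hv x
  refine ⟨ModuleCat.of R (P ⧸ LinearMap.range (j ∘ₗ i)), a, u, v, ses_range_mkQ _ hji,
    (injective_iff_map_eq_zero u).2 fun x hx => ?_, fun z => ?_, fun z => ?_⟩
  · obtain ⟨y, rfl⟩ := h.surjective x
    rw [hu'] at hx
    obtain ⟨k, hk⟩ := (ha _).1 hx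
    rw [← h'.injective hk]
    exact h.exact.apply_apply_eq_zero k
  · obtain ⟨x, rfl⟩ := has z
    rw [hv']
    constructor
    · intro hx
      obtain ⟨y, rfl⟩ := (h'.exact x).1 hx
      exact ⟨p y, hu' y⟩
    · rintro ⟨y, hy⟩
      obtain ⟨y, rfl⟩ := h.surjective y
      rw [hu'] at hy
      rw [← hv', ← hy, hv']
      exact h'.exact.apply_apply_eq_zero y
  · obtain ⟨x, rfl⟩ := h'.surjective z
    exact ⟨a x, hv' x⟩

theorem SES.exists_pushout {A B C D E : ModuleCat.{u} R} {a : A →ₗ[R] B} {b : B →ₗ[R] C}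
    {u : A →ₗ[R] D} {v : D →ₗ[R] E} (h : SES a b) (h' : SES u v) :
    ∃ (W : ModuleCat.{u} R) (i : D →ₗ[R] W) (p : W →ₗ[R] C) (j : B →ₗ[R] W) (q : W →ₗ[R] E),
      SES i p ∧ SES j q := by
  let φ : A →ₗ[R] (B × D) := a.prod (-u)
  have hφ : Function.Injective φ := fun x y hxy => h.injective (congrArg Prod.fst hxy)
  let w := (LinearMap.range φ).mkQ
  have hw : ∀ x, w x = 0 ↔ ∃ k, φ k = x := fun x => (ses_range_mkQ _ hφ).exact x
  have hws : Function.Surjective w := Submodule.mkQ_surjective _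
  have hba : ∀ x, b (a x) = 0 := fun x => h.exact.apply_apply_eq_zero x
  have hvu : ∀ x, v (u x) = 0 := fun x => h'.exact.apply_apply_eq_zero x
  have hglue : ∀ x y, w (a x, y) = w (0, u x + y) := fun x y => by
    rw [← sub_eq_zero, ← map_sub]
    refine (hw _).2 ⟨x, Prod.ext ?_ ?_⟩
    · change a x = a x - 0
      abel
    · change -u x = y - (u x + y)
      abel
  obtain ⟨p, hp⟩ := exists_comp_eq_of_surjective w hws (b ∘ₗ LinearMap.fst R B D) fun x hx => by
    obtain ⟨k, rfl⟩ := (hw _).1 hx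
    exact hba k
  obtain ⟨q, hq⟩ := exists_comp_eq_of_surjective w hws (v ∘ₗ LinearMap.snd R B D) fun x hx => by
    obtain ⟨k, rfl⟩ := (hw _).1 hx
    change v (-u k) = 0
    rw [map_neg, hvu, neg_zero]
  have hp' : ∀ x y, p (w (x, y)) = b x := fun x y => LinearMap.congr_fun hp (x, y)
  have hq' : ∀ x y, q (w (x, y)) = v y := fun x y => LinearMap.congr_fun hq (x, y)
  refine ⟨ModuleCat.of R ((B × D) ⧸ LinearMap.range φ), w ∘ₗ LinearMap.inr R B D, p,
    w ∘ₗ LinearMap.inl R B D, q, ⟨(injective_iff_map_eq_zero _).2 fun x hx => ?_, fun z => ?_,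
      fun z => ?_⟩, ⟨(injective_iff_map_eq_zero _).2 fun x hx => ?_, fun z => ?_, fun z => ?_⟩⟩
  · obtain ⟨k, hk⟩ := (hw _).1 hx
    have h1 : a k = 0 := congrArg Prod.fst hk
    have h2 : -u k = x := congrArg Prod.snd hk
    rw [← h2, h.injective (h1.trans (map_zero a).symm), map_zero, neg_zero]
  · obtain ⟨⟨x, y⟩, rfl⟩ := hws z
    rw [hp']
    constructor
    · intro hx
      obtain ⟨k, rfl⟩ := (h.exact x).1 hx
      exact ⟨u k + y, (hglue k y).symm⟩
    · rintro ⟨y', hy⟩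
      rw [← hp' x y, ← hy]
      exact (hp' 0 y').trans (map_zero b)
  · obtain ⟨x, rfl⟩ := h.surjective z
    exact ⟨w (x, 0), hp' x 0⟩
  · obtain ⟨k, hk⟩ := (hw _).1 hx
    have h1 : a k = x := congrArg Prod.fst hk
    have h2 : -u k = 0 := congrArg Prod.snd hk
    rw [← h1, h'.injective ((neg_eq_zero.1 h2).trans (map_zero u).symm), map_zero]
  · obtain ⟨⟨x, y⟩, rfl⟩ := hws z
    rw [hq']
    constructor
    · intro hy
      obtain ⟨k, rfl⟩ := (h'.exact y).1 hy
      refine ⟨x + a k, ?_⟩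
      have h1 : ((x + a k, 0) : B × D) = (x, 0) + (a k, 0) := by simp
      have h2 : ((x, u k) : B × D) = (x, 0) + (0, u k) := by simp
      change w (x + a k, 0) = w (x, u k)
      rw [h1, h2, map_add, map_add, hglue, add_zero]
    · rintro ⟨x', hx⟩
      rw [← hq' x y, ← hx]
      exact (hq' x' 0).trans (map_zero v)
  · obtain ⟨x, rfl⟩ := h'.surjective z
    exact ⟨w (0, x), hq' 0 x⟩

end ExactSequences

/-! ### Resolutions, approximations and dimension bounds. -/

section Resolutions

variable {C : ModuleCat.{u} R → Prop} {M : ModuleCat.{u} R}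

theorem HasResolution.exists_iso (h : HasResolution C M 0) : ∃ G, C G ∧ Nonempty (M ≅ G) := by
  obtain ⟨G, d, ε, h1, h2, -, h4, h5⟩ := h
  have : Subsingleton (G 1) := h5 1 one_pos
  have hinj : Function.Injective ε := (injective_iff_map_eq_zero ε).2 fun x hx => by
    obtain ⟨y, rfl⟩ := (h2 x).1 hx
    rw [Subsingleton.elim y 0, map_zero]
  exact ⟨G 0, h4 0 le_rfl, ⟨(LinearEquiv.ofBijective ε ⟨hinj, h1⟩).symm.toModuleIso⟩⟩

theorem HasResolution.exists_ses {n : ℕ} (h : HasResolution C M (n + 1)) :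
    ∃ (K G : ModuleCat.{u} R) (f : K →ₗ[R] G) (g : G →ₗ[R] M),
      C G ∧ HasResolution C K n ∧ SES f g := by
  obtain ⟨G, d, ε, h1, h2, h3, h4, h5⟩ := h
  have h0 : ∀ x, ε (d 0 x) = 0 := fun x => h2.apply_apply_eq_zero x
  refine ⟨ModuleCat.of R (LinearMap.ker ε), G 0, (LinearMap.ker ε).subtype, ε, h4 0 (by lia),
    ⟨fun k => G (k + 1), fun k => d (k + 1), (d 0).codRestrict _ h0, fun x => ?_, fun x => ?_,
      fun k => h3 (k + 1), fun k hk => h4 (k + 1) (by lia), fun k hk => h5 (k + 1) (by lia)⟩,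
    Subtype.val_injective, LinearMap.exact_subtype_ker_map ε, h1⟩
  · obtain ⟨y, hy⟩ := (h2 x.1).1 x.2
    exact ⟨y, Subtype.ext hy⟩
  · rw [← h3 0 x, Subtype.ext_iff]
    rfl

theorem hasResolution_zero (h : C M) : HasResolution C M 0 := by
  refine ⟨fun k => Nat.casesOn k M fun _ => ModuleCat.of R PUnit.{u + 1}, fun k => 0, LinearMap.id,
    Function.surjective_id, fun x => ?_, fun k x => ?_, fun k hk => ?_, fun k hk => ?_⟩
  · exact ⟨fun hx => ⟨0, hx.symm⟩, fun ⟨y, hy⟩ => hy.symm⟩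
  · exact ⟨fun _ => ⟨0, rfl⟩, fun _ => rfl⟩
  · obtain rfl : k = 0 := by lia
    exact h
  · obtain ⟨k, rfl⟩ : ∃ l, k = l + 1 := ⟨k - 1, by lia⟩
    exact inferInstanceAs (Subsingleton PUnit.{u + 1})

theorem HasResolution.cons {n : ℕ} {K G : ModuleCat.{u} R} {f : K →ₗ[R] G} {g : G →ₗ[R] M}
    (hs : SES f g) (hG : C G) (hK : HasResolution C K n) : HasResolution C M (n + 1) := by
  obtain ⟨X, d, ε, h1, h2, h3, h4, h5⟩ := hK
  refine ⟨fun k => Nat.casesOn k G X, fun k => Nat.rec (f ∘ₗ ε) (fun k _ => d k) k, g,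
    hs.surjective, fun x => ?_, fun k => ?_, fun k hk => ?_, fun k hk => ?_⟩
  · rw [hs.exact x]
    constructor
    · rintro ⟨y, rfl⟩
      obtain ⟨z, rfl⟩ := h1 y
      exact ⟨z, rfl⟩
    · rintro ⟨z, rfl⟩
      exact ⟨ε z, rfl⟩
  · cases k with
    | zero =>
      intro x
      refine Iff.trans ?_ (h2 x)
      change f (ε x) = 0 ↔ _
      exact ⟨fun h => hs.injective (h.trans (map_zero f).symm), fun h => by rw [h, map_zero]⟩
    | succ k => exact h3 k
  · cases k with
    | zero => exact hG
    | succ k => exact h4 k (by lia)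
  · obtain ⟨k, rfl⟩ : ∃ l, k = l + 1 := ⟨k - 1, by lia⟩
    exact h5 k (by lia)

theorem resolutionDim_le {n : ℕ} (h : HasResolution C M n) : resolutionDim C M ≤ n :=
  iInf₂_le n h

theorem exists_hasResolution_of_lt {a : ℕ∞} (h : resolutionDim C M < a) :
    ∃ n : ℕ, HasResolution C M n ∧ (n : ℕ∞) < a := by
  obtain ⟨n, hn⟩ := iInf_lt_iff.1 h
  obtain ⟨hr, hn⟩ := iInf_lt_iff.1 hn
  exact ⟨n, hr, hn⟩

open Abelian

theorem HasResolution.ext_covariant {F : ModuleCat.{u} R} {k : ℕ} (h : HasResolution C F k) {n : ℕ}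
    (H : ∀ i : ℕ, n < i → ∀ G, C G → Subsingleton (Ext.{u} M G i)) (i : ℕ) (hi : n < i) :
    Subsingleton (Ext.{u} M F i) := by
  induction k generalizing F i with
  | zero =>
    obtain ⟨G, hG, ⟨e⟩⟩ := h.exists_iso
    exact ext_of_iso_right e.symm (H i hi G hG)
  | succ k ih =>
    obtain ⟨K, G, f, g, hG, hK, hs⟩ := h.exists_ses
    exact hs.ext_right_covariant (H i hi G hG) (ih hK (i + 1) (by lia))

theorem HasResolution.ext_flat {k : ℕ} (h : HasResolution IsPGF M k) {F : ModuleCat.{u} R}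
    (hF : IsFlat F) (i : ℕ) (hi : k < i) : Subsingleton (Ext.{u} M F i) := by
  induction k generalizing M i with
  | zero =>
    obtain ⟨G, hG, ⟨e⟩⟩ := h.exists_iso
    obtain ⟨j, rfl⟩ : ∃ j, i = j + 1 := ⟨i - 1, by lia⟩
    exact ext_of_iso e (hG.extVanish hF j)
  | succ k ih =>
    obtain ⟨K, G, f, g, hG, hK, hs⟩ := h.exists_ses
    obtain ⟨j, rfl⟩ : ∃ j, i = j + 1 := ⟨i - 1, by lia⟩
    exact hs.ext_right (ih hK j (by lia)) (hG.extVanish hF j)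

/-- The class `C` is left open so that the same resolution serves for projective, flat and PGF
modules. -/
theorem hasResolution_of_hasProjectiveDimensionLT
    (hC : ∀ P : ModuleCat.{u} R, Module.Projective R P → C P) (n : ℕ)
    (h : HasProjectiveDimensionLT M (n + 1)) : HasResolution C M n := by
  induction n generalizing M with
  | zero =>
    have h' : HasProjectiveDimensionLT M 1 := h
    have : Projective (ModuleCat.of R M) := projective_iff_hasProjectiveDimensionLT_one.2 h'
    exact hasResolution_zero (hC M ((IsProjective.iff_projective M).2 this))
  | succ n ih =>
    obtain ⟨K, P, f, g, hP, hs⟩ := exists_projective_ses M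
    have : Projective (ModuleCat.of R P) := (IsProjective.iff_projective P).1 hP
    have h1 : HasProjectiveDimensionLT (ModuleCat.of R P) (n + 1) :=
      hasProjectiveDimensionLT_of_ge _ 1 _ (by lia)
    exact (ih (hs.shortExact.hasProjectiveDimensionLT_X₁ (n + 1) h1 h)).cons hs (hC P hP)

/-- Once the projective dimension is finite, projective test modules suffice. For `0 → K → P → Y →
0` in the top degree, `Ext(M, Y)` lies between `Ext(M, P) = 0` and the next `Ext(M, K) = 0`, so the
bound drops by one at a time. -/
theorem hasProjectiveDimensionLT_of_ext_projective {n : ℕ}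
    (H : ∀ i : ℕ, n ≤ i → ∀ P : ModuleCat.{u} R, Module.Projective R P →
      Subsingleton (Ext.{u} M P i)) (k : ℕ) (h : HasProjectiveDimensionLT M (n + k)) :
    HasProjectiveDimensionLT M n := by
  induction k with
  | zero => exact h
  | succ k ih =>
    refine ih ((hasProjectiveDimensionLT_iff.{u} M (n + k)).2 fun i hi Y e => ?_)
    obtain ⟨K, P, f, g, hP, hs⟩ := exists_projective_ses Y
    have := hs.ext_right_covariant (H i (by lia) P hP)
      (HasProjectiveDimensionLT.subsingleton.{u} M (n + (k + 1)) (i + 1) (by lia) K)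
    exact Subsingleton.elim _ _

/-- A module with a finite resolution by PGF-modules is a quotient of a PGF-module by a module of
finite projective dimension. -/
theorem HasResolution.exists_approximation {m : ℕ} (h : HasResolution IsPGF M m) :
    ∃ (K G : ModuleCat.{u} R) (f : K →ₗ[R] G) (g : G →ₗ[R] M),
      IsPGF G ∧ HasProjectiveDimensionLT K m ∧ SES f g := by
  induction m generalizing M with
  | zero =>
    obtain ⟨G, hG, ⟨e⟩⟩ := h.exists_iso
    refine ⟨ModuleCat.of R PUnit.{u + 1}, M, 0, LinearMap.id, hG.of_iso e.symm, ?_, ?_, ?_,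
      Function.surjective_id⟩
    · exact (ModuleCat.isZero_of_subsingleton
        (ModuleCat.of R PUnit.{u + 1})).hasProjectiveDimensionLT_zero
    · exact fun _ _ _ => rfl
    · exact fun x => ⟨fun hx => ⟨0, hx.symm⟩, fun ⟨_, hy⟩ => hy.symm⟩
  | succ m ih =>
    -- The approximation `K → G₁ → N` of the syzygy is turned around. Embedding `G₁` in a projective
    -- `P` and setting `L = P / K` gives `0 → N → L → G' → 0`, with the projective dimension of `L`
    -- at most `m`. The pushout `W` of `G` and `L` under `N` is an extension of `G'` by `G`, hence
    -- PGF, and `W / L = M`.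
    obtain ⟨N, G, a, b, hG, hN, hs⟩ := h.exists_ses
    obtain ⟨K, G₁, i, p, hG₁, hK, hs₁⟩ := ih hN
    obtain ⟨P, G', j, q, hP, hG', hs₂⟩ := hG₁.exists_ses
    obtain ⟨L, c, u, v, hL, hL'⟩ := hs₁.exists_quotient hs₂
    obtain ⟨W, d, e, j', q', hW, hW'⟩ := hs.exists_pushout hL'
    have : Projective (ModuleCat.of R P) := (IsProjective.iff_projective P).1 hP
    have h1 : HasProjectiveDimensionLT (ModuleCat.of R P) (m + 1) :=
      hasProjectiveDimensionLT_of_ge _ 1 _ (by lia)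
    exact ⟨L, W, d, e, IsPGF.of_ses hW' hG hG',
      hL.shortExact.hasProjectiveDimensionLT_X₃ m hK h1, hW⟩

theorem pgfDim_le_of_ext_projective {m : ℕ} (h : HasResolution IsPGF M m) (n : ℕ)
    (H : ∀ i : ℕ, n < i → ∀ P : ModuleCat.{u} R, Module.Projective R P →
      Subsingleton (Ext.{u} M P i)) : pgfDim M ≤ n := by
  obtain ⟨K, G, f, g, hG, hK, hs⟩ := h.exists_approximation
  cases n with
  -- `Ext¹(M, K) = 0` splits the approximation. The case is separate because the shift below needs
  -- positive degrees for `Ext(G, P)` to vanish.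
  | zero =>
    have hK' : HasResolution (fun P : ModuleCat.{u} R => Module.Projective R P) K m :=
      hasResolution_of_hasProjectiveDimensionLT (fun _ h => h) m
        (hasProjectiveDimensionLT_of_ge _ m _ (by lia))
    obtain ⟨ρ, hρ⟩ := hs.exists_extension (hK'.ext_covariant H 1 one_pos) LinearMap.id
    have hρ' : ∀ x, ρ (f x) = x := fun x => LinearMap.congr_fun hρ x
    obtain ⟨s, hs'⟩ := exists_comp_eq_of_surjective g hs.surjective (LinearMap.id - f ∘ₗ ρ)
      fun x hx => by
        obtain ⟨y, rfl⟩ := (hs.exact x).1 hx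
        change f y - f (ρ (f y)) = 0
        rw [hρ', sub_self]
    refine resolutionDim_le (hasResolution_zero (hG.of_retract s g (LinearMap.ext fun x => ?_)))
    obtain ⟨y, rfl⟩ := hs.surjective x
    rw [LinearMap.comp_apply, ← LinearMap.comp_apply s, hs']
    change g (y - f (ρ y)) = g y
    rw [map_sub, hs.exact.apply_apply_eq_zero, sub_zero]
  | succ n =>
    -- For `i ≥ n + 1`, `Ext` of `K` into a projective in degree `i` lies between that of `G` in
    -- degree `i` and that of `M` in degree `i + 1`, and both vanish.
    have hK' : HasProjectiveDimensionLT K (n + 1) :=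
      hasProjectiveDimensionLT_of_ext_projective (fun i hi P hP => by
        obtain ⟨j, rfl⟩ : ∃ j, i = j + 1 := ⟨i - 1, by lia⟩
        exact hs.ext_left (hG.extVanish (isFlat_of_projective hP) j) (H _ (by lia) P hP)) m
        (hasProjectiveDimensionLT_of_ge _ m _ (by lia))
    exact resolutionDim_le ((hasResolution_of_hasProjectiveDimensionLT
      (fun _ => isPGF_of_projective) n hK').cons hs hG)

end Resolutions

end PGF

/-! ### The equivalence of the five conditions. -/

theorem proposition3p6 {R : Type u} [Ring R] (M : ModuleCat.{u} R)
    (hM : PGF.pgfDim M < ⊤) (n : ℕ) :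
    List.TFAE [
      PGF.pgfDim M ≤ n,
      ∀ i : ℕ, n < i → ∀ F : ModuleCat.{u} R, PGF.IsFlat F →
        Subsingleton (Abelian.Ext.{u} M F i),
      ∀ i : ℕ, n < i → ∀ P : ModuleCat.{u} R, Module.Projective R P →
        Subsingleton (Abelian.Ext.{u} M P i),
      ∀ i : ℕ, n < i → ∀ F : ModuleCat.{u} R, PGF.flatDim F < ⊤ →
        Subsingleton (Abelian.Ext.{u} M F i),
      ∀ i : ℕ, n < i → ∀ P : ModuleCat.{u} R, projectiveDimension P < ⊤ →
        Subsingleton (Abelian.Ext.{u} M P i)] := by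
  obtain ⟨m, hm, -⟩ := PGF.exists_hasResolution_of_lt hM
  tfae_have 1 → 2 := by
    intro h i hi F hF
    -- Passing to the strict bound `n + 1` extracts an actual resolution of length at most `n` from
    -- the infimum.
    obtain ⟨k, hk, hkn⟩ := PGF.exists_hasResolution_of_lt
      (h.trans_lt (ENat.natCast_lt_natCast.2 (Nat.lt_succ_self n)))
    have : k < n + 1 := ENat.natCast_lt_natCast.1 hkn
    exact hk.ext_flat hF i (by lia)
  tfae_have 2 → 4 := by
    intro h i hi F hF
    obtain ⟨k, hk, -⟩ := PGF.exists_hasResolution_of_lt hF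
    exact hk.ext_covariant h i hi
  tfae_have 4 → 5 := by
    intro h i hi P hP
    obtain ⟨k, hk⟩ := (projectiveDimension_ne_top_iff P).1 hP.ne
    exact h i hi P ((PGF.resolutionDim_le (PGF.hasResolution_of_hasProjectiveDimensionLT
      (fun _ => PGF.isFlat_of_projective) k hk)).trans_lt (ENat.natCast_lt_top k))
  tfae_have 5 → 3 := by
    intro h i hi P hP
    have : Projective P := (IsProjective.iff_projective P).1 hP
    exact h i hi P (lt_top_iff_ne_top.2 ((projectiveDimension_ne_top_iff P).2
      ⟨0, (projective_iff_hasProjectiveDimensionLE_zero P).1 this⟩))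
  tfae_have 3 → 1 := PGF.pgfDim_le_of_ext_projective hm n
  tfae_finish
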